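/- **Trees.** A *tree* is a subset $T$ of $2^{<\omega_1}$ closed under initial segments, ordered by inclusion; $ht(x)$ is the length of $x$, $T_\alpha=T\cap 2^\alpha$, $T\!\upharpoonright\!\alpha=\bigcup_{\beta<\alpha}T_\beta$, and $ht(T)$ is the least $\alpha$ with $T_\alpha=\emptyset$. $T$ is *normal* if (1) for all $\alpha<\beta<ht(T)$ every $x\in T_\alpha$ has some $y\in T_\beta$ with $x<y$, and (2) whenever $\alpha+1<ht(T)$ and $x\in T_\alpha$ there are $\beta<ht(T)$ and distinct $y_1,y_2\in T_\beta$ with $x<y_1$ and $x<y_2$. $T\leq_{end}T'$ means $T'\!\upharpoonright\! ht(T)=T$. Let $\mathcal T$ be the set of all countable normal trees. **The poset.** Let $\kappa$ be a strongly inaccessible cardinal. A condition of $\mathbb P$ is a tuple $p=\langle\alpha_p,t_p,k_p,U_p,\langle b^p_\gamma:\gamma\in U_p\rangle,\langle f^p_\gamma:\gamma\in U_p\rangle\rangle$ such that (a) $\alpha_p<\omega_1$; (b) $t_p\in\mathcal T$ and $ht(t_p)=\alpha_p+1$; (c) $k_p:t_p\to\mathcal T$, $ht(k_p(x))=ht(x)+1$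 for $x\in t_p$, and $x<y$ implies $k_p(x)\leq_{end}k_p(y)$; (d) $U_p\subseteq\kappa$ and $|U_p|\leq\omega_1$; (e) for $\gamma\in U_p$, $b^p_\gamma$ is a function with domain $t_p\!\upharpoonright\!(\beta^p_\gamma+1)$ for some $\beta^p_\gamma\leq\alpha_p$, $b^p_\gamma(x)\in (k_p(x))_{ht(x)}$ for all $x$ in its domain, and $x\leq y$ implies $b^p_\gamma(x)\leq b^p_\gamma(y)$ for all $x,y\in t_p\!\upharpoonright\!\beta^p_\gamma$; (f) for $\gamma\in U_p$, $f^p_\gamma$ is a function from some $\delta^p_\gamma\leq\alpha_p$ to $\gamma$; (g) for every $x\in t_p\!\upharpoonright\!\alpha_p$, every finite $U_0\subseteq U_p$ and every $\epsilon$ with $ht(x)<\epsilon\leq\alpha_p$ there is $x'\in(t_p)_\epsilon$ with $x'>x$ such that for all $\gamma_1,\gamma_2\in U_0$: either one of $\beta^p_{\gamma_1},\beta^p_{\gamma_2}$ is less than $\epsilon$, or $b^p_{\gamma_1}(x)=b^p_{\gamma_2}(x)$ implies $b^p_{\gamma_1}(x')=b^p_{\gamma_2}(x')$. Put $p\leq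 q$ iff $\alpha_q\leq\alpha_p$, $t_q\leq_{end}t_p$, $k_q\subseteq k_p$, $U_q\subseteq U_p$; $b^q_\gamma\subseteq b^p_\gamma$ and $f^q_\gamma\subseteq f^p_\gamma$ for all $\gamma\in U_q$; and the sets $\{\gamma\in U_q:\beta^p_\gamma>\beta^q_\gamma\}$ and $\{\gamma\in U_q:\delta^p_\gamma>\delta^q_\gamma\}$ are at most countable. **The game.** For a poset $\mathbb Q$, players $I$ and $II$ alternately choose $p_n\in\mathbb Q$ (player $I$) and $q_n\in\mathbb Q$ (player $II$) so that $p_0\geq q_0\geq p_1\geq q_1\geq\cdots$; player $II$ wins iff $\langle p_0,q_0,p_1,q_1,\dots\rangle$ has a lower bound in $\mathbb Q$. $\mathbb Q$ is *$\omega_1$-strategically closed* if player $II$ has a winning strategy. **Lemma 12.** $\mathbb P$ is $\omega_1$-strategically closed. -/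

import Mathlib

universe u

namespace KurepaForcing

/-! ### The tree of binary sequences of countable length -/

/-- An element of `2^{<ω₁}`: a function `length → {0,1}` with `length < ω₁`. It is stored as a
function on all ordinals that takes the value `false` from `length` on, so that an element is
determined by `length` and by the values below `length`. -/
@[ext]
structure BinSeq : Type (u + 1) where
  /-- the domain of the sequence (its height in `2^{<ω₁}`) -/
  length : Ordinal.{u}
  /-- the entries -/
  val : Ordinal.{u} → Bool
  length_lt : length < Ordinal.omega 1
  val_of_length_le : ∀ ξ, length ≤ ξ → val ξ = false

namespace BinSeq

/-- The tree order of `2^{<ω₁}`: `x ≤ y` iff `x ⊆ y`, that is, `y` restricted to `x.length` is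
`x`. -/
instance : PartialOrder BinSeq.{u} where
  le x y := x.length ≤ y.length ∧ ∀ ξ < x.length, x.val ξ = y.val ξ
  le_refl _ := ⟨le_rfl, fun _ _ => rfl⟩
  le_trans _ _ _ h₁ h₂ :=
    ⟨h₁.1.trans h₂.1, fun ξ hξ => (h₁.2 ξ hξ).trans (h₂.2 ξ (hξ.trans_le h₁.1))⟩
  le_antisymm x y h₁ h₂ := by
    have hl : x.length = y.length := le_antisymm h₁.1 h₂.1
    refine BinSeq.ext hl (funext fun ξ => ?_)
    rcases lt_or_ge ξ x.length with h | h
    · exact h₁.2 ξ h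
    · rw [x.val_of_length_le ξ h, y.val_of_length_le ξ (hl ▸ h)]

end BinSeq

/-! ### Trees -/

/-- The `α`-th level `T_α` of `T`. -/
def level (T : Set BinSeq.{u}) (α : Ordinal.{u}) : Set BinSeq.{u} := {x ∈ T | x.length = α}

/-- `T ↾ α`, the union of the levels `T_β` with `β < α`. -/
def below (T : Set BinSeq.{u}) (α : Ordinal.{u}) : Set BinSeq.{u} := {x ∈ T | x.length < α}

/-- The height of `T`: the least ordinal `α` such that `T_α` is empty. -/
noncomputable def height (T : Set BinSeq.{u}) : Ordinal.{u} := sInf {α | level T α = ∅}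

/-- `T'` is an end-extension of `T`. -/
def EndExt (T T' : Set BinSeq.{u}) : Prop := below T' (height T) = T

/-- The class `𝒯` of countable normal trees: countable subtrees of `2^{<ω₁}` (closed under initial
segments) in which every node has extensions on all higher levels, and every node that is not on
the last level has two distinct extensions on some level. -/
structure IsCountableNormalTree (T : Set BinSeq.{u}) : Prop where
  isLowerSet : IsLowerSet T
  countable : T.Countable
  exists_extension : ∀ α β, α < β → β < height T → ∀ x ∈ level T α, ∃ y ∈ level T β, x < y
  exists_splitting : ∀ α, α + 1 < height T → ∀ x ∈ level T α,
    ∃ β < height T, ∃ y₁ ∈ level T β, ∃ y₂ ∈ level T β, y₁ ≠ y₂ ∧ x < y₁ ∧ x < y₂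

/-! ### The forcing notion -/

/-- Inclusion of partial functions, as sets of ordered pairs. -/
def PSub {A B : Type*} (f g : A →. B) : Prop := ∀ a, ∀ y ∈ f a, y ∈ g a

/-- A condition `⟨α, t, k, U, ⟨b γ : γ ∈ U⟩, ⟨f γ : γ ∈ U⟩⟩`. The domain of `b γ` is
`t ↾ (β γ + 1)` and the domain of `f γ` is `δ γ`. Outside `U` the families `b`, `f`, `β`, `δ` carry
no information: they are empty, respectively zero, there. -/
@[ext]
structure Cond (κ : Cardinal.{u}) : Type (u + 1) where
  α : Ordinal.{u}
  t : Set BinSeq.{u}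
  k : BinSeq.{u} →. Set BinSeq.{u}
  U : Set Ordinal.{u}
  b : Ordinal.{u} → (BinSeq.{u} →. BinSeq.{u})
  β : Ordinal.{u} → Ordinal.{u}
  f : Ordinal.{u} → (Ordinal.{u} →. Ordinal.{u})
  δ : Ordinal.{u} → Ordinal.{u}
  -- the height of the top level
  α_lt : α < Ordinal.omega 1
  -- the tree
  t_tree : IsCountableNormalTree t
  t_height : height t = α + 1
  -- the function from `t` to countable normal trees
  k_dom : k.Dom = t
  k_tree : ∀ x, ∀ T ∈ k x, IsCountableNormalTree T ∧ height T = x.length + 1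
  k_endExt : ∀ x y, x < y → ∀ T ∈ k x, ∀ T' ∈ k y, EndExt T T'
  -- the set of indices
  U_sub : ∀ γ ∈ U, γ < κ.ord
  U_card : Cardinal.mk U ≤ Cardinal.aleph 1
  -- the functions `b γ`
  β_le : ∀ γ ∈ U, β γ ≤ α
  b_dom : ∀ γ ∈ U, (b γ).Dom = below t (β γ + 1)
  b_mem : ∀ γ ∈ U, ∀ x, ∀ y ∈ b γ x, ∀ T ∈ k x, y ∈ level T x.length
  b_mono : ∀ γ ∈ U, ∀ x ∈ below t (β γ), ∀ x' ∈ below t (β γ), x ≤ x' →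
    ∀ y ∈ b γ x, ∀ y' ∈ b γ x', y ≤ y'
  -- the functions `f γ` from `δ γ` to `γ`
  δ_le : ∀ γ ∈ U, δ γ ≤ α
  f_dom : ∀ γ ∈ U, (f γ).Dom = Set.Iio (δ γ)
  f_lt : ∀ γ ∈ U, ∀ ξ, ∀ η ∈ f γ ξ, η < γ
  -- existence of conservative extensions
  conservative : ∀ x ∈ below t α, ∀ U₀ : Set Ordinal.{u}, U₀ ⊆ U → U₀.Finite →
    ∀ ε, x.length < ε → ε ≤ α → ∃ x' ∈ level t ε, x < x' ∧
      ∀ γ₁ ∈ U₀, ∀ γ₂ ∈ U₀, (β γ₁ < ε ∨ β γ₂ < ε) ∨ (b γ₁ x = b γ₂ x → b γ₁ x' = b γ₂ x')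
  -- no information outside `U`
  b_off : ∀ γ ∉ U, (b γ).Dom = ∅
  β_off : ∀ γ ∉ U, β γ = 0
  f_off : ∀ γ ∉ U, (f γ).Dom = ∅
  δ_off : ∀ γ ∉ U, δ γ = 0

namespace Cond

variable {κ : Cardinal.{u}}

/-- `p.Stronger q` means that `p` is a stronger condition than `q` (written `p ≤ q` below). -/
structure Stronger (p q : Cond κ) : Prop where
  α_le : q.α ≤ p.α
  t_endExt : EndExt q.t p.t
  k_sub : PSub q.k p.k
  U_sub : q.U ⊆ p.U
  b_sub : ∀ γ ∈ q.U, PSub (q.b γ) (p.b γ)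
  f_sub : ∀ γ ∈ q.U, PSub (q.f γ) (p.f γ)
  β_countable : {γ ∈ q.U | q.β γ < p.β γ}.Countable
  δ_countable : {γ ∈ q.U | q.δ γ < p.δ γ}.Countable

/-- Nodes of a tree lie below its height. -/
theorem length_lt_height {T : Set BinSeq.{u}} (hT : IsLowerSet T) {x : BinSeq.{u}} (hx : x ∈ T) :
    x.length < height T := by
  by_contra h
  rw [not_lt] at h
  have hne : {α | level T α = ∅}.Nonempty := by
    refine ⟨Ordinal.omega 1, ?_⟩
    ext y
    simp only [level, Set.mem_ofPred_eq, Set.mem_empty_iff_false, iff_false, not_and]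
    exact fun _ => y.length_lt.ne
  have h0 : level T (height T) = ∅ := csInf_mem hne
  classical
  let y : BinSeq.{u} :=
    { length := height T
      val := fun ξ => if ξ < height T then x.val ξ else false
      length_lt := h.trans_lt x.length_lt
      val_of_length_le := fun ξ hξ => if_neg hξ.not_gt }
  have hy : y ≤ x := ⟨h, fun ξ hξ => if_pos hξ⟩
  have hmem : y ∈ level T (height T) := ⟨hT hy hx, rfl⟩
  rw [h0] at hmem
  exact hmem

theorem level_nonempty {T : Set BinSeq.{u}} {α : Ordinal.{u}} (h : α < height T) :
    (level T α).Nonempty :=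
  Set.nonempty_iff_ne_empty.2 fun h0 => notMem_of_lt_csInf' h h0

theorem endExt_refl (p : Cond κ) : EndExt p.t p.t :=
  Set.ext fun _ => ⟨fun h => h.1, fun h => ⟨h, length_lt_height p.t_tree.isLowerSet h⟩⟩

theorem PSub.antisymm {A B : Type*} {f g : A →. B} (h₁ : PSub f g) (h₂ : PSub g f) : f = g :=
  funext fun a => Part.ext fun y => ⟨h₁ a y, h₂ a y⟩

theorem PSub.eq_of_dom_empty {A B : Type*} {f g : A →. B} (hf : f.Dom = ∅) (hg : g.Dom = ∅) :
    f = g := by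
  have key : ∀ h : A →. B, h.Dom = ∅ → ∀ a, ∀ y, y ∉ h a := fun h hh a y hy => by
    have : a ∈ h.Dom := (PFun.mem_dom h a).2 ⟨y, hy⟩
    rw [hh] at this
    exact this
  exact PSub.antisymm (fun a y hy => (key f hf a y hy).elim)
    (fun a y hy => (key g hg a y hy).elim)

theorem β_le_of_sub (p q : Cond κ) {γ : Ordinal.{u}} (hp : γ ∈ p.U)
    (hq : γ ∈ q.U) (h : p.b γ = q.b γ) : p.β γ ≤ q.β γ := by
  have hlt : p.β γ < height p.t := by
    rw [p.t_height]
    exact (p.β_le γ hp).trans_lt (Order.lt_succ p.α)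
  obtain ⟨x, hx, hxl⟩ := level_nonempty hlt
  have h1 : x ∈ (p.b γ).Dom := by
    rw [p.b_dom γ hp]
    exact ⟨hx, hxl.trans_lt (Order.lt_succ _)⟩
  rw [h, q.b_dom γ hq] at h1
  rw [← hxl]
  exact Order.lt_succ_iff.1 h1.2

/-- The order of the forcing notion. -/
instance : PartialOrder (Cond κ) where
  le := Stronger
  le_refl p :=
    { α_le := le_rfl
      t_endExt := endExt_refl p
      k_sub := fun _ _ h => h
      U_sub := subset_rfl
      b_sub := fun _ _ _ _ h => h
      f_sub := fun _ _ _ _ h => h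
      β_countable := by simp
      δ_countable := by simp }
  le_trans r q p h₁ h₂ :=
    { α_le := h₂.α_le.trans h₁.α_le
      t_endExt := by
        have e₁ := h₁.t_endExt
        have e₂ := h₂.t_endExt
        unfold EndExt at *
        have hh : height p.t ≤ height q.t := by
          rw [p.t_height, q.t_height]
          exact add_le_add_left h₂.α_le 1
        rw [← e₁] at e₂
        refine Eq.trans ?_ e₂
        ext x
        rw [e₁]
        constructor
        · exact fun h => ⟨by rw [← e₁]; exact ⟨h.1, h.2.trans_le hh⟩, h.2⟩
        · exact fun h => ⟨by have := h.1; rw [← e₁] at this; exact this.1, h.2⟩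
      k_sub := fun x y h => h₁.k_sub x y (h₂.k_sub x y h)
      U_sub := h₂.U_sub.trans h₁.U_sub
      b_sub := fun γ hγ x y h => h₁.b_sub γ (h₂.U_sub hγ) x y (h₂.b_sub γ hγ x y h)
      f_sub := fun γ hγ x y h => h₁.f_sub γ (h₂.U_sub hγ) x y (h₂.f_sub γ hγ x y h)
      β_countable := (h₁.β_countable.union h₂.β_countable).mono fun γ hγ => by
        rcases lt_or_ge (p.β γ) (q.β γ) with h | h
        · exact Or.inr ⟨hγ.1, h⟩
        · exact Or.inl ⟨h₂.U_sub hγ.1, h.trans_lt hγ.2⟩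
      δ_countable := (h₁.δ_countable.union h₂.δ_countable).mono fun γ hγ => by
        rcases lt_or_ge (p.δ γ) (q.δ γ) with h | h
        · exact Or.inr ⟨hγ.1, h⟩
        · exact Or.inl ⟨h₂.U_sub hγ.1, h.trans_lt hγ.2⟩ }
  le_antisymm p q h₁ h₂ := by
    have hα : p.α = q.α := le_antisymm h₂.α_le h₁.α_le
    have hU : p.U = q.U := subset_antisymm h₂.U_sub h₁.U_sub
    have ht : p.t = q.t := by
      have e := h₁.t_endExt
      unfold EndExt at e
      rw [q.t_height, ← hα, ← p.t_height] at e
      exact (endExt_refl p).symm.trans e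
    have hb : p.b = q.b := funext fun γ => by
      by_cases hγ : γ ∈ p.U
      · exact PSub.antisymm (h₂.b_sub γ hγ) (h₁.b_sub γ (hU ▸ hγ))
      · exact PSub.eq_of_dom_empty (p.b_off γ hγ) (q.b_off γ (hU ▸ hγ))
    have hf : p.f = q.f := funext fun γ => by
      by_cases hγ : γ ∈ p.U
      · exact PSub.antisymm (h₂.f_sub γ hγ) (h₁.f_sub γ (hU ▸ hγ))
      · exact PSub.eq_of_dom_empty (p.f_off γ hγ) (q.f_off γ (hU ▸ hγ))
    have hβ : p.β = q.β := funext fun γ => by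
      by_cases hγ : γ ∈ p.U
      · have hγ' : γ ∈ q.U := hU ▸ hγ
        exact le_antisymm (β_le_of_sub p q hγ hγ' (congrFun hb γ))
          (β_le_of_sub q p hγ' hγ (congrFun hb γ).symm)
      · rw [p.β_off γ hγ, q.β_off γ (hU ▸ hγ)]
    have hδ : p.δ = q.δ := funext fun γ => by
      by_cases hγ : γ ∈ p.U
      · have h := p.f_dom γ hγ
        rw [hf, q.f_dom γ (hU ▸ hγ)] at h
        exact (Set.Iio_injective h).symm
      · rw [p.δ_off γ hγ, q.δ_off γ (hU ▸ hγ)]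
    exact Cond.ext hα ht (PSub.antisymm h₂.k_sub h₁.k_sub) hU hb hβ hf hδ

end Cond

/-! ### The game -/

/-- A strategy for player II in the game in which player I chooses `p 0, p 1, …` and player II
chooses `q 0, q 1, …` in `Q` so that `p 0 ≥ q 0 ≥ p 1 ≥ q 1 ≥ …`: it computes `q n` from the moves
`p 0, …, p n` made by player I so far. -/
def StrategyII (Q : Type*) : Type _ := (n : ℕ) → (Fin (n + 1) → Q) → Q

/-- The `n`-th answer of player II when she follows `σ` and player I plays `p 0, p 1, …`. -/
def StrategyII.answer {Q : Type*} (σ : StrategyII Q) (p : ℕ → Q) (n : ℕ) : Q :=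
  σ n fun i => p i

/-- `σ` is a winning strategy for player II: as long as player I obeys the rules, the next answer
of player II is a legal move, and every infinite play in which she follows `σ` and player I obeys
the rules has a lower bound. -/
structure StrategyII.IsWinning {Q : Type*} [PartialOrder Q] (σ : StrategyII Q) : Prop where
  legal : ∀ (p : ℕ → Q) (n : ℕ), (∀ i < n, p (i + 1) ≤ σ.answer p i) → σ.answer p n ≤ p n
  lower_bound : ∀ p : ℕ → Q, (∀ i, p (i + 1) ≤ σ.answer p i) →
    ∃ r, ∀ n, r ≤ p n ∧ r ≤ σ.answer p n

/-- `Q` is `ω₁`-strategically closed: player II has a winning strategy in the game above. -/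
def IsStrategicallyClosed (Q : Type*) [PartialOrder Q] : Prop :=
  ∃ σ : StrategyII Q, σ.IsWinning

end KurepaForcing

/-!
At a limit of a play, a function `b γ` has to be given values on one more level, and this is
possible without further care in two cases: its domain was eventually constant, or its domains are
cofinal in the limit tree. In the second case the new level is the new last level of the tree, so
that the nodes and the assigned trees there can be chosen at will: over each node `x` and for each
finite set `V` of such indices one puts in a branch that is built by infinitely many applications of
the conservativity condition, and the tree assigned to this branch gets all the branches that the
functions `b γ` determine (`Cond.exists_lower_bound`). There are only countably many indices of the
second kind, since a stronger condition enlarges only countably many functions.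

Player II therefore adds a level in each move (`Cond.addLevel`), and takes care, infinitely often,
of each of the countably many `γ` whose function has been enlarged by player I, so that each
function falls under one of the two cases. The crucial point is that she can always
extend `b γ` either to the whole present tree or to a level from which no stronger condition
extends it any more (`Cond.exists_raise`). The second alternative is needed: when the values of
`b γ` are forced by the conservativity condition to follow functions `b γ'` with domains of
increasing heights, their union at the supremum of these heights may be missing from the
assigned tree. For the proof one assumes that no extension of `b γ` is final, and shows by induction
that every level can be reached. At a limit level `l`, over each node where `b γ` agrees with some
`b γ'` that reaches level `l` one copies such a `b γ'`; over the other nodes there is no restriction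
on the values at level `l`, and below `l` one uses the union of an increasing sequence of extensions
(`Cond.Raise.exists_limit`).
-/

namespace KurepaForcing

open Set

/-! ### Binary sequences -/

namespace BinSeq

theorem eq_of_le_of_length_le {x y : BinSeq.{u}} (h : x ≤ y) (hl : y.length ≤ x.length) :
    x = y := by
  refine le_antisymm h ⟨hl, fun ξ hξ => (h.2 ξ (hξ.trans_le hl)).symm⟩

theorem lt_iff_length {x y : BinSeq.{u}} : x < y ↔ x ≤ y ∧ x.length < y.length := by
  constructor
  · intro h
    refine ⟨h.le, lt_of_not_ge fun hl => h.ne (eq_of_le_of_length_le h.le hl)⟩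
  · rintro ⟨h, hl⟩
    exact lt_of_le_of_ne h fun e => hl.ne (by rw [e])

/-- The initial segments of a sequence are linearly ordered by their lengths. -/
theorem le_of_le_of_le {x y z : BinSeq.{u}} (hx : x ≤ z) (hy : y ≤ z)
    (hl : x.length ≤ y.length) : x ≤ y :=
  ⟨hl, fun ξ hξ => (hx.2 ξ hξ).trans (hy.2 ξ (hξ.trans_le hl)).symm⟩

theorem eq_of_le_of_le {x y z : BinSeq.{u}} (hx : x ≤ z) (hy : y ≤ z)
    (hl : x.length = y.length) : x = y :=
  eq_of_le_of_length_le (le_of_le_of_le hx hy hl.le) hl.ge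

open Classical in
/-- The restriction `x ↾ ξ`; it is `x` if `ξ` is at least the length of `x`. -/
noncomputable def restrict (x : BinSeq.{u}) (ξ : Ordinal.{u}) : BinSeq.{u} where
  length := min x.length ξ
  val η := if η < ξ then x.val η else false
  length_lt := (min_le_left _ _).trans_lt x.length_lt
  val_of_length_le η hη := by
    split_ifs with h
    · exact x.val_of_length_le η ((min_le_iff.1 hη).resolve_right h.not_ge)
    · rfl

theorem restrict_le (x : BinSeq.{u}) (ξ : Ordinal.{u}) : x.restrict ξ ≤ x :=
  ⟨min_le_left _ _, fun _ hη => if_pos (hη.trans_le (min_le_right _ _))⟩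

theorem length_restrict {x : BinSeq.{u}} {ξ : Ordinal.{u}} (h : ξ ≤ x.length) :
    (x.restrict ξ).length = ξ := min_eq_right h

theorem restrict_lt {x : BinSeq.{u}} {ξ : Ordinal.{u}} (h : ξ < x.length) :
    x.restrict ξ < x :=
  lt_iff_length.2 ⟨restrict_le _ _, by rwa [length_restrict h.le]⟩

theorem restrict_eq_of_le {x y : BinSeq.{u}} (h : x ≤ y) : y.restrict x.length = x :=
  eq_of_le_of_le (restrict_le _ _) h (length_restrict h.1)

theorem le_restrict {x y : BinSeq.{u}} {ξ : Ordinal.{u}} (h : x ≤ y) (hx : x.length ≤ ξ) :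
    x ≤ y.restrict ξ :=
  le_of_le_of_le h (restrict_le _ _) (le_min h.1 hx)

open Classical in
/-- The sequence `x⌢i`. -/
noncomputable def snoc (x : BinSeq.{u}) (i : Bool) : BinSeq.{u} where
  length := x.length + 1
  val η := if η = x.length then i else x.val η
  length_lt := (Cardinal.isSuccLimit_omega 1).add_one_lt x.length_lt
  val_of_length_le η hη := by
    have h : x.length < η := Order.add_one_le_iff.1 hη
    rw [if_neg h.ne', x.val_of_length_le η h.le]

theorem lt_snoc (x : BinSeq.{u}) (i : Bool) : x < x.snoc i :=
  lt_iff_length.2 ⟨⟨(lt_add_one x.length).le, fun _ hη => (if_neg hη.ne).symm⟩,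
    lt_add_one x.length⟩

theorem snoc_injective (x : BinSeq.{u}) : Function.Injective x.snoc := by
  intro i j h
  have := congrArg (fun y => y.val x.length) h
  simpa [snoc] using this

/-- An increasing sequence of binary sequences has a union. -/
theorem exists_union {c : ℕ → BinSeq.{u}} (hc : Monotone c) {a : Ordinal.{u}}
    (ha : a < Ordinal.omega 1) (hle : ∀ n, (c n).length ≤ a) :
    ∃ d : BinSeq.{u}, d.length = a ∧ ∀ n, c n ≤ d := by
  classical
  refine ⟨⟨a, fun ξ => if h : ∃ n, ξ < (c n).length then (c h.choose).val ξ else false, ha, ?_⟩,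
    rfl, fun n => ⟨hle n, fun ξ hξ => ?_⟩⟩
  · intro ξ hξ
    exact dif_neg fun ⟨n, hn⟩ => (hn.trans_le (hle n)).not_ge hξ
  · have h : ∃ n, ξ < (c n).length := ⟨n, hξ⟩
    change _ = if h : ∃ n, ξ < (c n).length then (c h.choose).val ξ else false
    rw [dif_pos h]
    rcases le_total n h.choose with h' | h'
    · exact (hc h').2 ξ hξ
    · exact ((hc h').2 ξ h.choose_spec).symm

/-- Two sequences with common initial segments of cofinally many lengths are equal. -/
theorem eq_of_common_segments {x y : BinSeq.{u}} {a : Ordinal.{u}} (hx : x.length = a)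
    (hy : y.length = a) (h : ∀ ξ < a, ∃ z, z ≤ x ∧ z ≤ y ∧ ξ < z.length) : x = y := by
  refine BinSeq.ext (hx.trans hy.symm) (funext fun ξ => ?_)
  rcases lt_or_ge ξ a with hξ | hξ
  · obtain ⟨z, hzx, hzy, hz⟩ := h ξ hξ
    rw [← hzx.2 ξ hz, hzy.2 ξ hz]
  · rw [x.val_of_length_le ξ (hx.trans_le hξ), y.val_of_length_le ξ (hy.trans_le hξ)]

end BinSeq

open BinSeq

/-! ### Countable normal trees of successor height -/

theorem height_eq {T : Set BinSeq.{u}} (hT : IsLowerSet T) {a : Ordinal.{u}}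
    (h₁ : (level T a).Nonempty) (h₂ : ∀ x ∈ T, x.length ≤ a) : height T = a + 1 := by
  refine le_antisymm ?_ ?_
  · refine csInf_le' ?_
    refine Set.eq_empty_of_forall_notMem fun x hx => ?_
    have h := h₂ x hx.1
    rw [hx.2] at h
    exact (lt_add_one a).not_ge h
  · obtain ⟨x, hx, rfl⟩ := h₁
    exact Order.add_one_le_iff.2 (Cond.length_lt_height hT hx)

theorem length_le_of_mem {T : Set BinSeq.{u}} (hT : IsLowerSet T) {a : Ordinal.{u}}
    (ha : height T = a + 1) {x : BinSeq.{u}} (hx : x ∈ T) : x.length ≤ a :=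
  Order.lt_add_one_iff.1 (ha ▸ Cond.length_lt_height hT hx)

theorem EndExt.subset {T T' : Set BinSeq.{u}} (h : EndExt T T') : T ⊆ T' :=
  fun x hx => (show x ∈ below T' (height T) from h.symm ▸ hx).1

theorem EndExt.mem_of_length_le {T T' : Set BinSeq.{u}} (h : EndExt T T') {a : Ordinal.{u}}
    (ha : height T = a + 1) {x : BinSeq.{u}} (hx : x ∈ T') (hxa : x.length ≤ a) : x ∈ T := by
  rw [← h]
  exact ⟨hx, by rw [ha]; exact Order.lt_add_one_iff.2 hxa⟩

theorem endExt_of {T T' : Set BinSeq.{u}} (hT : IsLowerSet T) {a : Ordinal.{u}}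
    (ha : height T = a + 1) (h₁ : T ⊆ T') (h₂ : ∀ x ∈ T', x.length ≤ a → x ∈ T) :
    EndExt T T' := by
  ext x
  constructor
  · exact fun hx => h₂ x hx.1 (Order.lt_add_one_iff.1 (ha ▸ hx.2))
  · exact fun hx => ⟨h₁ hx, Cond.length_lt_height hT hx⟩

theorem EndExt.trans {T T' T'' : Set BinSeq.{u}} (hT : IsLowerSet T) {a b : Ordinal.{u}}
    (ha : height T = a + 1) (hb : height T' = b + 1) (hab : a ≤ b) (h : EndExt T T')
    (h' : EndExt T' T'') : EndExt T T'' :=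
  endExt_of hT ha (h.subset.trans h'.subset) fun _ hz hzl =>
    h.mem_of_length_le ha (h'.mem_of_length_le hb hz (hzl.trans hab)) hzl

theorem IsCountableNormalTree.exists_le {T : Set BinSeq.{u}} (hT : IsCountableNormalTree T)
    {b : Ordinal.{u}} (hb : b < height T) {x : BinSeq.{u}} (hx : x ∈ T) (hxb : x.length ≤ b) :
    ∃ y ∈ level T b, x ≤ y := by
  rcases hxb.lt_or_eq with h | h
  · obtain ⟨y, hy, hxy⟩ := hT.exists_extension _ _ h hb x ⟨hx, rfl⟩
    exact ⟨y, hy, hxy.le⟩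
  · exact ⟨x, ⟨hx, h⟩, le_rfl⟩

/-- The tree `T` of height `a + 1` with both immediate successors of each node of the last level
added. -/
def addLevel (a : Ordinal.{u}) (T : Set BinSeq.{u}) : Set BinSeq.{u} :=
  T ∪ {y | y.length = a + 1 ∧ y.restrict a ∈ T}

section addLevel

variable {T : Set BinSeq.{u}} {a : Ordinal.{u}}

theorem snoc_mem_addLevel {x : BinSeq.{u}} (hx : x ∈ level T a) (i : Bool) :
    x.snoc i ∈ level (addLevel a T) (a + 1) := by
  have hl : (x.snoc i).length = a + 1 := by rw [← hx.2]; rfl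
  refine ⟨Or.inr ⟨hl, ?_⟩, hl⟩
  have := restrict_eq_of_le (lt_snoc x i).le
  rw [hx.2] at this
  rw [this]
  exact hx.1

theorem isLowerSet_addLevel (hT : IsLowerSet T) : IsLowerSet (addLevel a T) := by
  rintro y x hxy (hy | ⟨hy, hy'⟩)
  · exact Or.inl (hT hxy hy)
  · rcases hxy.1.lt_or_eq with h | h
    · rw [hy, Order.lt_add_one_iff] at h
      exact Or.inl (hT (le_restrict hxy h) hy')
    · rw [eq_of_le_of_length_le hxy h.ge]
      exact Or.inr ⟨hy, hy'⟩

theorem height_addLevel (hT : IsLowerSet T) (ha : height T = a + 1) :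
    height (addLevel a T) = a + 1 + 1 := by
  obtain ⟨x, hx⟩ := Cond.level_nonempty (T := T) (α := a) (by rw [ha]; exact lt_add_one a)
  refine height_eq (isLowerSet_addLevel hT) ⟨_, snoc_mem_addLevel hx true⟩ ?_
  rintro y (hy | hy)
  · exact (length_le_of_mem hT ha hy).trans (lt_add_one a).le
  · exact hy.1.le

theorem endExt_addLevel (hT : IsLowerSet T) (ha : height T = a + 1) :
    EndExt T (addLevel a T) := by
  refine endExt_of hT ha subset_union_left ?_
  rintro x (hx | hx) hl
  · exact hx
  · exact absurd hl (by rw [hx.1]; exact (lt_add_one a).not_ge)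

theorem addLevel_normal (hT : IsCountableNormalTree T) (ha : height T = a + 1) :
    IsCountableNormalTree (addLevel a T) where
  isLowerSet := isLowerSet_addLevel hT.isLowerSet
  countable := by
    refine hT.countable.union ?_
    have : ({y : BinSeq.{u} | y.length = a + 1 ∧ y.restrict a ∈ T}) ⊆
        (fun q : BinSeq.{u} × Bool => q.1.snoc q.2) '' (T ×ˢ univ) := by
      rintro y ⟨hy, hy'⟩
      have hay : a ≤ y.length := hy ▸ (lt_add_one a).le
      refine ⟨(y.restrict a, y.val a), ⟨hy', mem_univ _⟩, ?_⟩
      have hl := length_restrict hay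
      refine eq_of_le_of_length_le ⟨?_, fun ξ hξ => ?_⟩ ?_
      · simp [snoc, hl, hy]
      · simp only [snoc, hl] at hξ ⊢
        split_ifs with h
        · rw [h]
        · exact if_pos ((Order.lt_add_one_iff.1 hξ).lt_of_ne h)
      · simp [snoc, hl, hy]
    exact ((hT.countable.prod (countable_univ (α := Bool))).image _).mono this
  exists_extension := by
    intro b c hbc hc x hx
    rw [height_addLevel hT.isLowerSet ha, Order.lt_add_one_iff] at hc
    have hxT : x ∈ T := (endExt_addLevel hT.isLowerSet ha).mem_of_length_le ha hx.1
      (by rw [hx.2]; exact Order.lt_add_one_iff.1 (hbc.trans_le hc))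
    rcases hc.lt_or_eq with hc | rfl
    · obtain ⟨y, hy, hxy⟩ := hT.exists_extension b c hbc (ha ▸ hc) x ⟨hxT, hx.2⟩
      exact ⟨y, ⟨Or.inl hy.1, hy.2⟩, hxy⟩
    · obtain ⟨y, hy, hxy⟩ := hT.exists_le (b := a) (by rw [ha]; exact lt_add_one a) hxT
        (by rw [hx.2]; exact Order.lt_add_one_iff.1 hbc)
      exact ⟨_, snoc_mem_addLevel hy true, hxy.trans_lt (lt_snoc y true)⟩
  exists_splitting := by
    intro b hb x hx
    rw [height_addLevel hT.isLowerSet ha] at *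
    have hb' : b < a + 1 := lt_of_add_lt_add_right hb
    have hxT : x ∈ T := (endExt_addLevel hT.isLowerSet ha).mem_of_length_le ha hx.1
      (by rw [hx.2]; exact Order.lt_add_one_iff.1 hb')
    obtain ⟨y, hy, hxy⟩ := hT.exists_le (b := a) (by rw [ha]; exact lt_add_one a) hxT
        (by rw [hx.2]; exact Order.lt_add_one_iff.1 hb')
    refine ⟨a + 1, lt_add_one _, _, snoc_mem_addLevel hy true, _,
      snoc_mem_addLevel hy false, fun h => ?_,
      hxy.trans_lt (lt_snoc y _), hxy.trans_lt (lt_snoc y _)⟩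
    exact Bool.noConfusion (snoc_injective y h)

end addLevel

/-! ### Limits of increasing sequences of trees -/

/-- If each node of the last level of `T n` has a successor in the last level of `T (n + 1)` to
which it is related by `R`, then each node of the last level of `T n` lies on a cofinal branch
that is formed by such successors. -/
theorem exists_branch {T : ℕ → Set BinSeq.{u}} {a : ℕ → Ordinal.{u}} {l : Ordinal.{u}}
    (hl : IsLUB (range a) l) (hlim : ∀ n, a n < l) (hω : l < Ordinal.omega 1)
    {R : BinSeq.{u} → BinSeq.{u} → Prop}
    (hR : ∀ n, ∀ x ∈ level (T n) (a n), ∃ y ∈ level (T (n + 1)) (a (n + 1)), x < y ∧ R x y)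
    {n : ℕ} {x : BinSeq.{u}} (hx : x ∈ level (T n) (a n)) :
    ∃ w : BinSeq.{u}, w.length = l ∧ x < w ∧ (∀ m ≥ n, w.restrict (a m) ∈ T m) ∧
      ∀ m ≥ n, R (w.restrict (a m)) (w.restrict (a (m + 1))) := by
  choose! s hs hsx hsR using hR
  let c : ℕ → BinSeq.{u} := fun m => Nat.rec x (fun i y => s (n + i) y) m
  have c0 : c 0 = x := rfl
  have cs : ∀ m, c (m + 1) = s (n + m) (c m) := fun m => rfl
  have hc : ∀ m, c m ∈ level (T (n + m)) (a (n + m)) := by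
    intro m
    induction m with
    | zero => exact hx
    | succ m ih => rw [cs]; exact hs _ _ ih
  have hmono : StrictMono c := strictMono_nat_of_lt_succ fun m => by
    rw [cs]; exact hsx _ _ (hc m)
  obtain ⟨w, hw, hcw⟩ := exists_union hmono.monotone hω
    (fun m => by rw [(hc m).2]; exact hl.1 ⟨_, rfl⟩)
  have hres : ∀ m, w.restrict (a (n + m)) = c m := fun m => by
    rw [← (hc m).2]; exact restrict_eq_of_le (hcw m)
  refine ⟨w, hw, ?_, ?_, ?_⟩
  · refine lt_iff_length.2 ⟨hcw 0, ?_⟩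
    rw [hx.2, hw]; exact hlim n
  · intro m hm
    obtain ⟨i, rfl⟩ := Nat.exists_eq_add_of_le hm
    rw [hres]; exact (hc i).1
  · intro m hm
    obtain ⟨i, rfl⟩ := Nat.exists_eq_add_of_le hm
    rw [hres, add_assoc, hres, cs]
    exact hsR _ _ (hc i)

theorem endExt_of_le {T : ℕ → Set BinSeq.{u}} {a : ℕ → Ordinal.{u}} (ha : Monotone a)
    (hT : ∀ n, IsLowerSet (T n)) (hh : ∀ n, height (T n) = a n + 1)
    (he : ∀ n, EndExt (T n) (T (n + 1))) {m n : ℕ} (hmn : m ≤ n) : EndExt (T m) (T n) := by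
  refine endExt_of (hT m) (hh m) ?_ ?_
  · exact monotone_nat_of_le_succ (f := T) (fun n => (he n).subset) hmn
  · induction n, hmn using Nat.le_induction with
    | base => exact fun x hx _ => hx
    | succ n hmn ih =>
      exact fun x hx hl => ih x ((he n).mem_of_length_le (hh n) hx (hl.trans (ha hmn))) hl

/-- The union of an increasing sequence of countable normal trees, with countably many cofinal
branches added on top, is a countable normal tree if these branches cover the union. -/
theorem limit_tree {T : ℕ → Set BinSeq.{u}} {a : ℕ → Ordinal.{u}} (ha : StrictMono a)
    {l : Ordinal.{u}} (hl : IsLUB (range a) l)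
    (hT : ∀ n, IsCountableNormalTree (T n)) (hh : ∀ n, height (T n) = a n + 1)
    (he : ∀ n, EndExt (T n) (T (n + 1))) {B : Set BinSeq.{u}} (hB : B.Countable)
    (hBl : ∀ w ∈ B, w.length = l) (hBT : ∀ w ∈ B, ∀ x < w, ∃ n, x ∈ T n)
    (hcov : ∀ n, ∀ x ∈ T n, ∃ w ∈ B, x < w) :
    IsCountableNormalTree ((⋃ n, T n) ∪ B) ∧ height ((⋃ n, T n) ∪ B) = l + 1 ∧
      ∀ n, EndExt (T n) ((⋃ n, T n) ∪ B) := by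
  have hlt : ∀ n, a n < l := fun n => (ha (Nat.lt_succ_self n)).trans_le (hl.1 ⟨_, rfl⟩)
  have hlow : IsLowerSet ((⋃ n, T n) ∪ B) := by
    rintro y x hxy (hy | hy)
    · obtain ⟨n, hn⟩ := mem_iUnion.1 hy
      exact Or.inl (mem_iUnion.2 ⟨n, (hT n).isLowerSet hxy hn⟩)
    · rcases hxy.lt_or_eq with h | rfl
      · exact Or.inl (mem_iUnion.2 (hBT y hy x h))
      · exact Or.inr hy
  have hlen : ∀ n, ∀ x ∈ T n, x.length ≤ a n := fun n x hx =>
    length_le_of_mem (hT n).isLowerSet (hh n) hx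
  have hend : ∀ n, EndExt (T n) ((⋃ n, T n) ∪ B) := by
    intro n
    refine endExt_of (hT n).isLowerSet (hh n)
      (fun x hx => Or.inl (mem_iUnion.2 ⟨n, hx⟩)) ?_
    rintro x (hx | hx) hxl
    · obtain ⟨m, hm⟩ := mem_iUnion.1 hx
      rcases le_total m n with h | h
      · exact (endExt_of_le ha.monotone (fun n => (hT n).isLowerSet) hh he h).subset hm
      · exact (endExt_of_le ha.monotone (fun n => (hT n).isLowerSet) hh he h).mem_of_length_le
          (hh n) hm hxl
    · rw [hBl x hx] at hxl
      exact absurd hxl (hlt n).not_ge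
  have hheight : height ((⋃ n, T n) ∪ B) = l + 1 := by
    obtain ⟨x, hx⟩ := Cond.level_nonempty (T := T 0) (α := a 0)
      (by rw [hh]; exact lt_add_one _)
    obtain ⟨w, hw, -⟩ := hcov 0 x hx.1
    refine height_eq hlow ⟨w, Or.inr hw, hBl w hw⟩ ?_
    rintro y (hy | hy)
    · obtain ⟨n, hn⟩ := mem_iUnion.1 hy
      exact (hlen n y hn).trans (hlt n).le
    · exact (hBl y hy).le
  -- a node of the limit tree below its last level lies in all later trees of the sequence
  have hmem : ∀ b < l, ∀ x ∈ level ((⋃ n, T n) ∪ B) b, ∀ c < l, ∃ n, x ∈ level (T n) b ∧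
      c < a n := by
    intro b hb x hx c hc
    obtain ⟨_, ⟨n, rfl⟩, hn⟩ := (lt_isLUB_iff hl).1 (max_lt hb hc)
    exact ⟨n, ⟨(hend n).mem_of_length_le (hh n) hx.1
      (by rw [hx.2]; exact ((le_max_left _ _).trans_lt hn).le), hx.2⟩,
      (le_max_right _ _).trans_lt hn⟩
  refine ⟨⟨hlow, (countable_iUnion fun n => (hT n).countable).union hB, ?_, ?_⟩, hheight, hend⟩
  · intro b c hbc hc x hx
    rw [hheight, Order.lt_add_one_iff] at hc
    rcases hc.lt_or_eq with hc | rfl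
    · obtain ⟨n, hn, hcn⟩ := hmem b (hbc.trans hc) x hx c hc
      obtain ⟨y, hy, hxy⟩ := (hT n).exists_extension b c hbc
        (by rw [hh]; exact Order.lt_add_one_iff.2 hcn.le) x hn
      exact ⟨y, ⟨(hend n).subset hy.1, hy.2⟩, hxy⟩
    · obtain ⟨n, hn, -⟩ := hmem b hbc x hx b hbc
      obtain ⟨w, hw, hxw⟩ := hcov n x hn.1
      exact ⟨w, ⟨Or.inr hw, hBl w hw⟩, hxw⟩
  · intro b hb x hx
    rw [hheight] at hb ⊢
    have hb' : b < l := lt_of_add_lt_add_right hb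
    obtain ⟨n, hn, hbn⟩ := hmem b hb' x hx b hb'
    obtain ⟨c, hc, y₁, hy₁, y₂, hy₂, h⟩ := (hT n).exists_splitting b
      (by rw [hh]; simpa using hbn) x hn
    refine ⟨c, ?_, y₁, ⟨(hend n).subset hy₁.1, hy₁.2⟩, y₂, ⟨(hend n).subset hy₂.1, hy₂.2⟩, h⟩
    rw [hh, Order.lt_add_one_iff] at hc
    exact hc.trans_lt ((hlt n).trans (lt_add_one l))

/-- Along an increasing sequence of countable normal trees, countably many prescribed cofinal
branches can be realized in the last level of a common end-extension. -/
theorem exists_limit_tree {T : ℕ → Set BinSeq.{u}} {a : ℕ → Ordinal.{u}} (ha : StrictMono a)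
    {l : Ordinal.{u}} (hl : IsLUB (range a) l) (hω : l < Ordinal.omega 1)
    (hT : ∀ n, IsCountableNormalTree (T n)) (hh : ∀ n, height (T n) = a n + 1)
    (he : ∀ n, EndExt (T n) (T (n + 1))) {B : Set BinSeq.{u}} (hB : B.Countable)
    (hBl : ∀ w ∈ B, w.length = l) (hBT : ∀ w ∈ B, ∀ x < w, ∃ n, x ∈ T n) :
    ∃ T', IsCountableNormalTree T' ∧ height T' = l + 1 ∧ (∀ n, EndExt (T n) T') ∧ B ⊆ T' := by
  have hlt : ∀ n, a n < l := fun n => (ha (Nat.lt_succ_self n)).trans_le (hl.1 ⟨_, rfl⟩)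
  have key : ∀ x : BinSeq.{u}, (∃ n, x ∈ T n) →
      ∃ w : BinSeq.{u}, w.length = l ∧ x < w ∧ ∀ y < w, ∃ n, y ∈ T n := by
    rintro x ⟨n, hx⟩
    obtain ⟨y, hy, hxy⟩ := (hT n).exists_le (b := a n) (by rw [hh]; exact lt_add_one _) hx
      (length_le_of_mem (hT n).isLowerSet (hh n) hx)
    obtain ⟨w, hw, hyw, hwT, -⟩ := exists_branch (T := T) (R := fun _ _ => True) hl hlt hω
      (fun n x hx => by
        obtain ⟨y, hy, hxy⟩ := (hT (n + 1)).exists_extension (a n) (a (n + 1))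
          (ha (Nat.lt_succ_self n)) (by rw [hh]; exact lt_add_one _) x
          ⟨(he n).subset hx.1, hx.2⟩
        exact ⟨y, hy, hxy, trivial⟩) hy
    refine ⟨w, hw, hxy.trans_lt hyw, fun z hz => ?_⟩
    obtain ⟨_, ⟨m, rfl⟩, hm⟩ := (lt_isLUB_iff hl).1 (hw ▸ (lt_iff_length.1 hz).2)
    have hm' := hm.trans_le (ha.monotone (le_max_left m n))
    exact ⟨max m n, (hT _).isLowerSet (le_restrict hz.le hm'.le) (hwT _ (le_max_right _ _))⟩
  choose! W hWl hWx hWT using key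
  refine ⟨(⋃ n, T n) ∪ (B ∪ W '' ⋃ n, T n), ?_⟩
  obtain ⟨h₁, h₂, h₃⟩ := limit_tree ha hl hT hh he (B := B ∪ W '' ⋃ n, T n)
    (hB.union ((countable_iUnion fun n => (hT n).countable).image _))
    (by
      rintro w (hw | ⟨x, hx, rfl⟩)
      · exact hBl w hw
      · exact hWl x (mem_iUnion.1 hx))
    (by
      rintro w (hw | ⟨x, hx, rfl⟩)
      · exact hBT w hw
      · exact hWT x (mem_iUnion.1 hx))
    (fun n x hx => ⟨W x, Or.inr ⟨x, mem_iUnion.2 ⟨n, hx⟩, rfl⟩, hWx x ⟨n, hx⟩⟩)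
  exact ⟨h₁, h₂, h₃, fun w hw => Or.inr (Or.inl hw)⟩

/-! ### Components of conditions -/

theorem PSub.eq_of_mem_dom {A B : Type*} {f g : A →. B} (h : PSub f g) {a : A} (ha : a ∈ f.Dom) :
    f a = g a := by
  obtain ⟨y, hy⟩ := (PFun.mem_dom f a).1 ha
  rw [Part.eq_some_iff.2 hy, Part.eq_some_iff.2 (h a y hy)]

namespace Cond

variable {κ : Cardinal.{u}}

section components

variable (p : Cond κ) {γ : Ordinal.{u}} {x y : BinSeq.{u}}

theorem mem_below_iff {ξ : Ordinal.{u}} : x ∈ below p.t (ξ + 1) ↔ x ∈ p.t ∧ x.length ≤ ξ :=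
  and_congr_right fun _ => Order.lt_add_one_iff

theorem length_le (hx : x ∈ p.t) : x.length ≤ p.α :=
  length_le_of_mem p.t_tree.isLowerSet p.t_height hx

theorem exists_k (hx : x ∈ p.t) : ∃ T, T ∈ p.k x :=
  (PFun.mem_dom p.k x).1 (p.k_dom ▸ hx)

theorem mem_t_of_k {T : Set BinSeq.{u}} (h : T ∈ p.k x) : x ∈ p.t :=
  p.k_dom ▸ (PFun.mem_dom p.k x).2 ⟨T, h⟩

theorem mem_dom_b (hγ : γ ∈ p.U) (hx : x ∈ p.t) (hl : x.length ≤ p.β γ) : x ∈ (p.b γ).Dom := by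
  rw [p.b_dom γ hγ]
  exact p.mem_below_iff.2 ⟨hx, hl⟩

theorem exists_b (hγ : γ ∈ p.U) (hx : x ∈ p.t) (hl : x.length ≤ p.β γ) : ∃ y, y ∈ p.b γ x :=
  (PFun.mem_dom _ x).1 (p.mem_dom_b hγ hx hl)

theorem mem_U_of_b (h : y ∈ p.b γ x) : γ ∈ p.U := by
  by_contra hγ
  have : x ∈ (p.b γ).Dom := (PFun.mem_dom _ x).2 ⟨y, h⟩
  rw [p.b_off γ hγ] at this
  exact this

theorem mem_U_of_f {ξ η : Ordinal.{u}} (h : η ∈ p.f γ ξ) : γ ∈ p.U := by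
  by_contra hγ
  have : ξ ∈ (p.f γ).Dom := (PFun.mem_dom _ ξ).2 ⟨η, h⟩
  rw [p.f_off γ hγ] at this
  exact this

theorem mem_t_of_b (h : y ∈ p.b γ x) : x ∈ p.t ∧ x.length ≤ p.β γ := by
  have : x ∈ (p.b γ).Dom := (PFun.mem_dom _ x).2 ⟨y, h⟩
  rw [p.b_dom γ (p.mem_U_of_b h)] at this
  exact p.mem_below_iff.1 this

theorem length_b (h : y ∈ p.b γ x) : y.length = x.length := by
  obtain ⟨T, hT⟩ := p.exists_k (p.mem_t_of_b h).1
  exact (p.b_mem γ (p.mem_U_of_b h) x y h T hT).2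

theorem b_mono' {x' y' : BinSeq.{u}} (h : y ∈ p.b γ x) (h' : y' ∈ p.b γ x')
    (hxx' : x ≤ x') (hl : x'.length < p.β γ) : y ≤ y' :=
  p.b_mono γ (p.mem_U_of_b h) x ⟨(p.mem_t_of_b h).1, hxx'.1.trans_lt hl⟩ x'
    ⟨(p.mem_t_of_b h').1, hl⟩ hxx' y h y' h'

end components

section order

variable {p q : Cond κ} {γ : Ordinal.{u}} {x y : BinSeq.{u}}

theorem t_subset (h : q ≤ p) : p.t ⊆ q.t := EndExt.subset (Stronger.t_endExt h)

theorem mem_t_of_le (h : q ≤ p) (hx : x ∈ q.t) (hl : x.length ≤ p.α) : x ∈ p.t :=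
  EndExt.mem_of_length_le (Stronger.t_endExt h) p.t_height hx hl

theorem b_eq (h : q ≤ p) (hγ : γ ∈ p.U) (hx : x ∈ p.t) (hl : x.length ≤ p.β γ) :
    p.b γ x = q.b γ x :=
  (Stronger.b_sub h γ hγ).eq_of_mem_dom (p.mem_dom_b hγ hx hl)

theorem mem_b (h : q ≤ p) (hy : y ∈ p.b γ x) : y ∈ q.b γ x :=
  Stronger.b_sub h γ (p.mem_U_of_b hy) x y hy

theorem β_mono (h : q ≤ p) (hγ : γ ∈ p.U) : p.β γ ≤ q.β γ := by
  have hlt : p.β γ < height p.t := by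
    rw [p.t_height]
    exact Order.lt_add_one_iff.2 (p.β_le γ hγ)
  obtain ⟨x, hx, hxl⟩ := level_nonempty hlt
  obtain ⟨y, hy⟩ := p.exists_b hγ hx hxl.le
  rw [← hxl]
  exact (q.mem_t_of_b (mem_b h hy)).2

theorem β_mono_all (h : q ≤ p) (γ : Ordinal.{u}) : p.β γ ≤ q.β γ := by
  by_cases hγ : γ ∈ p.U
  · exact β_mono h hγ
  · rw [p.β_off γ hγ]
    exact zero_le

theorem δ_mono_all (h : q ≤ p) (γ : Ordinal.{u}) : p.δ γ ≤ q.δ γ := by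
  by_cases hγ : γ ∈ p.U
  · rw [← Iio_subset_Iio_iff, ← p.f_dom γ hγ, ← q.f_dom γ (Stronger.U_sub h hγ)]
    intro ξ hξ
    obtain ⟨η, hη⟩ := (PFun.mem_dom _ ξ).1 hξ
    exact (PFun.mem_dom _ ξ).2 ⟨η, Stronger.f_sub h γ hγ ξ η hη⟩
  · rw [p.δ_off γ hγ]
    exact zero_le

end order

/-! ### Adding a level to the tree of a condition -/

open Classical in
/-- The condition that arises from `p` by adding one level to its tree: each node of the last level
gets both successors, and the trees assigned to these also grow by one level. -/
noncomputable def addLevel (p : Cond κ) : Cond κ where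
  α := p.α + 1
  t := KurepaForcing.addLevel p.α p.t
  k x := if x.length = p.α + 1 then (p.k (x.restrict p.α)).map (KurepaForcing.addLevel p.α)
    else p.k x
  U := p.U
  b := p.b
  β := p.β
  f := p.f
  δ := p.δ
  α_lt := (Cardinal.isSuccLimit_omega 1).add_one_lt p.α_lt
  t_tree := addLevel_normal p.t_tree p.t_height
  t_height := height_addLevel p.t_tree.isLowerSet p.t_height
  k_dom := by
    ext x
    refine (PFun.mem_dom _ x).trans ?_
    change (∃ T, T ∈ ite _ _ _) ↔ _
    split_ifs with hx
    · simp only [Part.mem_map_iff]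
      constructor
      · rintro ⟨_, T, hT, rfl⟩
        exact Or.inr ⟨hx, p.mem_t_of_k hT⟩
      · rintro (h | h)
        · have := p.length_le h
          rw [hx] at this
          exact absurd this (lt_add_one _).not_ge
        · obtain ⟨T, hT⟩ := p.exists_k h.2
          exact ⟨_, T, hT, rfl⟩
    · constructor
      · rintro ⟨T, hT⟩
        exact Or.inl (p.mem_t_of_k hT)
      · rintro (h | h)
        · exact p.exists_k h
        · exact absurd h.1 hx
  k_tree := by
    intro x T hT
    split_ifs at hT with hx
    · obtain ⟨S, hS, rfl⟩ := (Part.mem_map_iff _).1 hT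
      obtain ⟨h₁, h₂⟩ := p.k_tree _ S hS
      rw [length_restrict (hx ▸ (lt_add_one _).le)] at h₂
      rw [hx]
      exact ⟨addLevel_normal h₁ h₂, height_addLevel h₁.isLowerSet h₂⟩
    · exact p.k_tree x T hT
  k_endExt := by
    intro x y hxy T hT T' hT'
    have hlen := (lt_iff_length.1 hxy).2
    split_ifs at hT' with hy
    · have hx : x.length ≤ p.α := Order.lt_add_one_iff.1 (hy ▸ hlen)
      rw [if_neg (hx.trans_lt (lt_add_one _)).ne] at hT
      obtain ⟨S, hS, rfl⟩ := (Part.mem_map_iff _).1 hT'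
      obtain ⟨h₁, h₂⟩ := p.k_tree _ S hS
      obtain ⟨h₃, h₄⟩ := p.k_tree _ T hT
      rw [length_restrict (hy ▸ (lt_add_one _).le)] at h₂
      have hSe := endExt_addLevel h₁.isLowerSet h₂
      have hle := le_restrict hxy.le hx
      rcases hle.lt_or_eq with h | h
      · exact (p.k_endExt x _ h T hT S hS).trans h₃.isLowerSet h₄ h₂ hx hSe
      · rw [← h] at hS
        rwa [Part.mem_unique hT hS]
    · have hyt := p.length_le (p.mem_t_of_k hT')
      rw [if_neg ((hlen.trans_le hyt).trans (lt_add_one _)).ne] at hT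
      exact p.k_endExt x y hxy T hT T' hT'
  U_sub := p.U_sub
  U_card := p.U_card
  β_le γ hγ := (p.β_le γ hγ).trans (lt_add_one _).le
  b_dom γ hγ := by
    rw [p.b_dom γ hγ]
    ext x
    refine ⟨fun h => ⟨Or.inl h.1, h.2⟩, fun h => ⟨?_, h.2⟩⟩
    exact (endExt_addLevel p.t_tree.isLowerSet p.t_height).mem_of_length_le p.t_height h.1
      ((Order.lt_add_one_iff.1 h.2).trans (p.β_le γ hγ))
  b_mem γ hγ x y hy T hT := by
    rw [if_neg ((p.length_le (p.mem_t_of_b hy).1).trans_lt (lt_add_one _)).ne] at hT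
    exact p.b_mem γ hγ x y hy T hT
  b_mono γ hγ x hx x' hx' := by
    have key : ∀ z ∈ below (KurepaForcing.addLevel p.α p.t) (p.β γ), z ∈ below p.t (p.β γ) :=
      fun z hz => ⟨(endExt_addLevel p.t_tree.isLowerSet p.t_height).mem_of_length_le
        p.t_height hz.1 (hz.2.le.trans (p.β_le γ hγ)), hz.2⟩
    exact p.b_mono γ hγ x (key x hx) x' (key x' hx')
  δ_le γ hγ := (p.δ_le γ hγ).trans (lt_add_one _).le
  f_dom := p.f_dom
  f_lt := p.f_lt
  conservative x hx U₀ hU₀ hfin ε hxε hε := by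
    have he := endExt_addLevel p.t_tree.isLowerSet p.t_height
    rcases hε.lt_or_eq with hε | rfl
    · rw [Order.lt_add_one_iff] at hε
      have hxt := he.mem_of_length_le p.t_height hx.1 (hxε.trans_le hε).le
      obtain ⟨x', hx', h⟩ := p.conservative x ⟨hxt, hxε.trans_le hε⟩ U₀ hU₀ hfin ε hxε hε
      exact ⟨x', ⟨he.subset hx'.1, hx'.2⟩, h⟩
    · obtain ⟨x', hx', hxx'⟩ := (addLevel_normal p.t_tree p.t_height).exists_extension _ (p.α + 1)
        hxε (by rw [height_addLevel p.t_tree.isLowerSet p.t_height]; exact lt_add_one _) x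
        ⟨hx.1, rfl⟩
      exact ⟨x', hx', hxx', fun γ₁ hγ₁ _ _ =>
        Or.inl (Or.inl (Order.lt_add_one_iff.2 (p.β_le γ₁ (hU₀ hγ₁))))⟩
  b_off := p.b_off
  β_off := p.β_off
  f_off := p.f_off
  δ_off := p.δ_off

theorem addLevel_le (p : Cond κ) : p.addLevel ≤ p where
  α_le := (lt_add_one p.α).le
  t_endExt := endExt_addLevel p.t_tree.isLowerSet p.t_height
  k_sub x T hT := by
    have := (p.length_le (p.mem_t_of_k hT)).trans_lt (lt_add_one _)
    change T ∈ ite _ _ _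
    rwa [if_neg this.ne]
  U_sub := subset_rfl
  b_sub _ _ _ _ h := h
  f_sub _ _ _ _ h := h
  β_countable := by simp [addLevel]
  δ_countable := by simp [addLevel]

/-! ### Conservative extensions of nodes -/

/-- At `x'`, the functions `b γ` with `γ ∈ V` that are defined there satisfy all the equalities
that they satisfy at `x`. -/
def Conserves (p : Cond κ) (V : Set Ordinal.{u}) (x x' : BinSeq.{u}) : Prop :=
  ∀ γ₁ ∈ V, ∀ γ₂ ∈ V, x'.length ≤ p.β γ₁ → x'.length ≤ p.β γ₂ →
    p.b γ₁ x = p.b γ₂ x → p.b γ₁ x' = p.b γ₂ x'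

theorem exists_conserves (p : Cond κ) {x : BinSeq.{u}} (hx : x ∈ p.t) {V : Set Ordinal.{u}}
    (hV : V ⊆ p.U) (hfin : V.Finite) {ε : Ordinal.{u}} (hxε : x.length < ε) (hε : ε ≤ p.α) :
    ∃ x' ∈ level p.t ε, x < x' ∧ p.Conserves V x x' := by
  obtain ⟨x', hx', hxx', h⟩ := p.conservative x ⟨hx, hxε.trans_le hε⟩ V hV hfin ε hxε hε
  refine ⟨x', hx', hxx', fun γ₁ h₁ γ₂ h₂ hl₁ hl₂ => ?_⟩
  rw [hx'.2] at hl₁ hl₂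
  rcases h γ₁ h₁ γ₂ h₂ with (h | h) | h
  · exact absurd hl₁ h.not_ge
  · exact absurd hl₂ h.not_ge
  · exact h

theorem Conserves.mono {p : Cond κ} {V W : Set Ordinal.{u}} {x x' : BinSeq.{u}}
    (h : p.Conserves W x x') (hVW : V ⊆ W) : p.Conserves V x x' :=
  fun γ₁ h₁ γ₂ h₂ => h γ₁ (hVW h₁) γ₂ (hVW h₂)

/-- `p.Conserves V x x'`, also for the equalities of the functions `b γ` with an additional
function `B`. -/
def ConservesWith (p : Cond κ) (B : BinSeq.{u} →. BinSeq.{u}) (V : Set Ordinal.{u})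
    (x x' : BinSeq.{u}) : Prop :=
  p.Conserves V x x' ∧ ∀ γ ∈ V, x'.length ≤ p.β γ → p.b γ x = B x → p.b γ x' = B x'

theorem ConservesWith.trans {p : Cond κ} {B : BinSeq.{u} →. BinSeq.{u}} {V : Set Ordinal.{u}}
    {x y z : BinSeq.{u}} (h₁ : p.ConservesWith B V x y) (h₂ : p.ConservesWith B V y z)
    (hyz : y ≤ z) : p.ConservesWith B V x z :=
  ⟨fun γ₁ hγ₁ γ₂ hγ₂ hl₁ hl₂ he => h₂.1 γ₁ hγ₁ γ₂ hγ₂ hl₁ hl₂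
      (h₁.1 γ₁ hγ₁ γ₂ hγ₂ (hyz.1.trans hl₁) (hyz.1.trans hl₂) he),
    fun γ hγ hl he => h₂.2 γ hγ hl (h₁.2 γ hγ (hyz.1.trans hl) he)⟩

theorem ConservesWith.congr {p : Cond κ} {B B' : BinSeq.{u} →. BinSeq.{u}} {V : Set Ordinal.{u}}
    {x x' : BinSeq.{u}} (h : p.ConservesWith B V x x') (hx : B' x = B x) (hx' : B' x' = B x') :
    p.ConservesWith B' V x x' := by
  unfold ConservesWith
  rw [hx, hx']
  exact h

/-! ### Raising a single function of a condition -/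

/-- The function `B` with domain `t ↾ (m + 1)` extends `b g`, and it may replace `b g` in `p`
(see `Cond.update`). -/
structure Raise (p : Cond κ) (g m : Ordinal.{u}) (B : BinSeq.{u} →. BinSeq.{u}) : Prop where
  β_le : p.β g ≤ m
  le_α : m ≤ p.α
  sub : PSub (p.b g) B
  dom : B.Dom = below p.t (m + 1)
  mem : ∀ x, ∀ y ∈ B x, ∀ T ∈ p.k x, y ∈ level T x.length
  mono : ∀ x x' y y', y ∈ B x → y' ∈ B x' → x ≤ x' → x'.length < m → y ≤ y'
  conservative : ∀ x ∈ p.t, ∀ V ⊆ p.U, g ∉ V → V.Finite → ∀ ε, x.length < ε → ε ≤ m →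
    ∃ x' ∈ level p.t ε, x < x' ∧ p.ConservesWith B V x x'

section raise

variable {p : Cond κ} {g m : Ordinal.{u}} {B : BinSeq.{u} →. BinSeq.{u}}

theorem Raise.mem_dom (h : p.Raise g m B) {x : BinSeq.{u}} (hx : x ∈ p.t) (hl : x.length ≤ m) :
    x ∈ B.Dom := by
  rw [h.dom]
  exact p.mem_below_iff.2 ⟨hx, hl⟩

theorem Raise.exists_mem (h : p.Raise g m B) {x : BinSeq.{u}} (hx : x ∈ p.t)
    (hl : x.length ≤ m) : ∃ y, y ∈ B x :=
  (PFun.mem_dom B x).1 (h.mem_dom hx hl)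

theorem Raise.mem_t (h : p.Raise g m B) {x y : BinSeq.{u}} (hy : y ∈ B x) :
    x ∈ p.t ∧ x.length ≤ m := by
  have : x ∈ B.Dom := (PFun.mem_dom B x).2 ⟨y, hy⟩
  rw [h.dom] at this
  exact p.mem_below_iff.1 this

theorem Raise.length (h : p.Raise g m B) {x y : BinSeq.{u}} (hy : y ∈ B x) :
    y.length = x.length := by
  obtain ⟨T, hT⟩ := p.exists_k (h.mem_t hy).1
  exact (h.mem x y hy T hT).2

/-- If `r ≤ p` then the restriction of `b g` of `r` to a level of the tree of `p` can replace
`b g` in `p`. -/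
theorem raise_of_le {r : Cond κ} (h : r ≤ p) (hg : g ∈ p.U) (hm : p.β g ≤ m) (hmα : m ≤ p.α)
    (hmr : m ≤ r.β g) :
    ∃ B, p.Raise g m B ∧ ∀ x ∈ p.t, x.length ≤ m → B x = r.b g x := by
  classical
  have hgr := Stronger.U_sub h hg
  have hB : ∀ x ∈ p.t, x.length ≤ m →
      (fun x => if x.length ≤ m then r.b g x else Part.none : BinSeq.{u} →. BinSeq.{u}) x =
        r.b g x := fun x hx hl => if_pos hl
  refine ⟨fun x => if x.length ≤ m then r.b g x else Part.none, ?_, hB⟩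
  have hmem : ∀ x y, y ∈ (fun x => if x.length ≤ m then r.b g x else Part.none :
      BinSeq.{u} →. BinSeq.{u}) x → x.length ≤ m ∧ x ∈ p.t ∧ y ∈ r.b g x := by
    intro x y hy
    change y ∈ ite _ _ _ at hy
    split_ifs at hy with hl
    · exact ⟨hl, mem_t_of_le h (r.mem_t_of_b hy).1 (hl.trans hmα), hy⟩
    · exact absurd hy (Part.notMem_none y)
  refine ⟨hm, hmα, ?_, ?_, ?_, ?_, ?_⟩
  · intro x y hy
    obtain ⟨hx, hl⟩ := p.mem_t_of_b hy
    rw [hB x hx (hl.trans hm)]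
    exact mem_b h hy
  · ext x
    rw [p.mem_below_iff]
    refine (PFun.mem_dom _ x).trans ⟨?_, ?_⟩
    · rintro ⟨y, hy⟩
      exact ⟨(hmem x y hy).2.1, (hmem x y hy).1⟩
    · rintro ⟨hx, hl⟩
      obtain ⟨y, hy⟩ := r.exists_b hgr (t_subset h hx) (hl.trans hmr)
      refine ⟨y, ?_⟩
      rwa [if_pos hl]
  · intro x y hy T hT
    exact r.b_mem g hgr x y (hmem x y hy).2.2 T (Stronger.k_sub h x T hT)
  · intro x x' y y' hy hy' hxx' hl
    exact r.b_mono' (hmem x y hy).2.2 (hmem x' y' hy').2.2 hxx' (hl.trans_le hmr)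
  · intro x hx V hV hgV hfin ε hxε hε
    obtain ⟨x', hx', hxx', hc⟩ := r.exists_conserves (t_subset h hx) (V := insert g V)
      (insert_subset hgr (hV.trans (Stronger.U_sub h))) (hfin.insert g) hxε
      ((hε.trans hmα).trans (Stronger.α_le h))
    have hx't : x' ∈ p.t := mem_t_of_le h hx'.1 (by rw [hx'.2]; exact hε.trans hmα)
    have hb : ∀ γ ∈ V, x'.length ≤ p.β γ → p.b γ x = r.b γ x ∧ p.b γ x' = r.b γ x' ∧
        x'.length ≤ r.β γ := fun γ hγ hl =>
      ⟨b_eq h (hV hγ) hx (hxx'.le.1.trans hl), b_eq h (hV hγ) hx't hl,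
        hl.trans (β_mono h (hV hγ))⟩
    refine ⟨x', ⟨hx't, hx'.2⟩, hxx', ?_, ?_⟩
    · intro γ₁ h₁ γ₂ h₂ hl₁ hl₂ he
      obtain ⟨e₁, e₁', hr₁⟩ := hb γ₁ h₁ hl₁
      obtain ⟨e₂, e₂', hr₂⟩ := hb γ₂ h₂ hl₂
      rw [e₁', e₂']
      rw [e₁, e₂] at he
      exact hc γ₁ (Or.inr h₁) γ₂ (Or.inr h₂) hr₁ hr₂ he
    · intro γ hγ hl he
      obtain ⟨e, e', hr⟩ := hb γ hγ hl
      rw [hB x hx (hxε.le.trans hε), e] at he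
      rw [hB x' hx't (hx'.2.trans_le hε), e']
      exact hc γ (Or.inr hγ) g (Or.inl rfl) hr (by rw [hx'.2]; exact hε.trans hmr) he

open Classical in
/-- The condition `p` with `b g` replaced by `B`. -/
noncomputable def update (p : Cond κ) (hg : g ∈ p.U) (h : p.Raise g m B) : Cond κ :=
  { p with
    b := Function.update p.b g B
    β := Function.update p.β g m
    β_le := by
      intro γ hγ
      rcases eq_or_ne γ g with rfl | hne
      · rw [Function.update_self]; exact h.le_α
      · rw [Function.update_of_ne hne]; exact p.β_le γ hγ
    b_dom := by
      intro γ hγ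
      rcases eq_or_ne γ g with rfl | hne
      · rw [Function.update_self, Function.update_self]; exact h.dom
      · rw [Function.update_of_ne hne, Function.update_of_ne hne]; exact p.b_dom γ hγ
    b_mem := by
      intro γ hγ
      rcases eq_or_ne γ g with rfl | hne
      · rw [Function.update_self]; exact h.mem
      · rw [Function.update_of_ne hne]; exact p.b_mem γ hγ
    b_mono := by
      intro γ hγ
      rcases eq_or_ne γ g with rfl | hne
      · rw [Function.update_self, Function.update_self]
        exact fun x _ x' hx' hxx' y hy y' hy' => h.mono x x' y y' hy hy' hxx' hx'.2
      · rw [Function.update_of_ne hne, Function.update_of_ne hne]; exact p.b_mono γ hγ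
    conservative := by
      intro x hx V hV hfin ε hxε hε
      have hVg : V \ {g} ⊆ p.U := sdiff_subset.trans hV
      have hgV : g ∉ V \ {g} := fun h => h.2 rfl
      have hfin' : (V \ {g}).Finite := hfin.subset sdiff_subset
      -- above level `m` the value at `g` plays no role
      obtain ⟨x', hx', hxx', hc, hcB⟩ : ∃ x' ∈ level p.t ε, x < x' ∧ p.Conserves (V \ {g}) x x' ∧
          (ε ≤ m → ∀ γ ∈ V \ {g}, x'.length ≤ p.β γ → p.b γ x = B x → p.b γ x' = B x') := by
        rcases le_or_gt ε m with hεm | hεm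
        · obtain ⟨x', hx', hxx', hc, hcB⟩ := h.conservative x hx.1 _ hVg hgV hfin' ε hxε hεm
          exact ⟨x', hx', hxx', hc, fun _ => hcB⟩
        · obtain ⟨x', hx', hxx', hc⟩ := p.exists_conserves hx.1 hVg hfin' hxε hε
          exact ⟨x', hx', hxx', hc, fun hle => absurd hεm hle.not_gt⟩
      refine ⟨x', hx', hxx', fun γ₁ h₁ γ₂ h₂ => ?_⟩
      rw [or_iff_not_imp_left]
      intro hne
      rw [not_or, not_lt, not_lt] at hne
      obtain ⟨hl₁, hl₂⟩ := hne
      rcases eq_or_ne γ₁ g with hg₁ | hg₁ <;> rcases eq_or_ne γ₂ g with hg₂ | hg₂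
      · rw [hg₁, hg₂]; exact fun _ => rfl
      · rw [hg₁, Function.update_self] at hl₁ ⊢
        rw [Function.update_of_ne hg₂] at hl₂ ⊢
        exact fun he => (hcB hl₁ γ₂ ⟨h₂, hg₂⟩ (hx'.2.trans_le hl₂) he.symm).symm
      · rw [hg₂, Function.update_self] at hl₂ ⊢
        rw [Function.update_of_ne hg₁] at hl₁ ⊢
        exact fun he => hcB hl₂ γ₁ ⟨h₁, hg₁⟩ (hx'.2.trans_le hl₁) he
      · rw [Function.update_of_ne hg₁] at hl₁ ⊢
        rw [Function.update_of_ne hg₂] at hl₂ ⊢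
        exact hc γ₁ ⟨h₁, hg₁⟩ γ₂ ⟨h₂, hg₂⟩ (hx'.2.trans_le hl₁) (hx'.2.trans_le hl₂)
    b_off := by
      intro γ hγ
      have hne : γ ≠ g := fun e => hγ (e ▸ hg)
      rw [Function.update_of_ne hne]; exact p.b_off γ hγ
    β_off := by
      intro γ hγ
      have hne : γ ≠ g := fun e => hγ (e ▸ hg)
      rw [Function.update_of_ne hne]; exact p.β_off γ hγ }

theorem update_b (hg : g ∈ p.U) (h : p.Raise g m B) : (p.update hg h).b g = B := by
  classical
  exact Function.update_self g B p.b

theorem update_β (hg : g ∈ p.U) (h : p.Raise g m B) : (p.update hg h).β g = m := by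
  classical
  exact Function.update_self g m p.β

theorem update_le (hg : g ∈ p.U) (h : p.Raise g m B) : p.update hg h ≤ p where
  α_le := le_rfl
  t_endExt := endExt_refl p
  k_sub _ _ h := h
  U_sub := subset_rfl
  b_sub γ _ := by
    classical
    rcases eq_or_ne γ g with rfl | hne
    · rw [update_b]; exact h.sub
    · change PSub _ (Function.update p.b g B γ)
      rw [Function.update_of_ne hne]; exact fun _ _ h => h
  f_sub _ _ _ _ h := h
  β_countable := by
    classical
    refine (countable_singleton g).mono fun γ hγ => ?_
    by_contra hne
    have : p.β γ < Function.update p.β g m γ := hγ.2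
    rw [Function.update_of_ne hne] at this
    exact this.false
  δ_countable := by simp [update]

theorem raise_self (hg : g ∈ p.U) : p.Raise g (p.β g) (p.b g) := by
  obtain ⟨B, hB, h⟩ := raise_of_le (le_refl p) hg le_rfl (p.β_le g hg) le_rfl
  convert hB
  refine PSub.antisymm hB.sub fun x y hy => ?_
  rwa [h x (hB.mem_t hy).1 (hB.mem_t hy).2] at hy

theorem Raise.trans_le (hg : g ∈ p.U) (h : p.Raise g m B) {r : Cond κ} (hr : r ≤ p.update hg h)
    {l : Ordinal.{u}} (hml : m ≤ l) (hl : l ≤ p.α) (hlr : l ≤ r.β g) :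
    ∃ B', p.Raise g l B' ∧ PSub B B' := by
  obtain ⟨B', hB', he⟩ := raise_of_le (hr.trans (update_le hg h)) hg (h.β_le.trans hml) hl hlr
  refine ⟨B', hB', fun x y hy => ?_⟩
  obtain ⟨hx, hxl⟩ := h.mem_t hy
  rw [he x hx (hxl.trans hml)]
  have := mem_b hr (γ := g) (x := x) (y := y)
  rw [update_b] at this
  exact this hy

theorem countable_Iio_of_lt_omega_one {l : Ordinal.{u}} (hl : l < Ordinal.omega 1) :
    (Iio l).Countable := by
  rw [← Cardinal.le_aleph0_iff_set_countable, Cardinal.mk_Iio_ordinal, Cardinal.lift_le_aleph0,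
    ← Order.lt_succ_iff, Cardinal.succ_aleph0, ← Cardinal.lt_ord, Cardinal.ord_aleph]
  exact hl

/-- Raising through a limit level `l`: if all raisings to levels below `l` can be continued to all
levels below `l`, then they can be continued to `l`. Over a node `y` of level `m` at which `B` takes
the value of some `b γ` that reaches level `l`, one has to follow such a `b γ`. Over the other nodes
of level `m`, the union of an increasing sequence of raisings serves below level `l`, and the
values at level `l` are arbitrary. -/
theorem Raise.exists_limit (hm : p.Raise g m B) {l : Ordinal.{u}} (hml : m < l)
    (hl : l ≤ p.α) (hlim : ∀ ξ < l, ξ + 1 < l)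
    (ih : ∀ m' < l, ∀ n B', p.Raise g n B' → n ≤ m' → ∃ B'', p.Raise g m' B'' ∧ PSub B' B'') :
    ∃ B', p.Raise g l B' ∧ PSub B B' := by
  classical
  -- a sequence of raisings to levels cofinal in `l`
  obtain ⟨e, he⟩ := countable_iff_exists_subset_range.1
    (countable_Iio_of_lt_omega_one (hl.trans_lt p.α_lt))
  have step : ∀ (s : {s : Ordinal.{u} × (BinSeq.{u} →. BinSeq.{u}) //
      p.Raise g s.1 s.2 ∧ s.1 < l}) (ξ : Ordinal.{u}),
      ∃ s' : {s : Ordinal.{u} × (BinSeq.{u} →. BinSeq.{u}) // p.Raise g s.1 s.2 ∧ s.1 < l},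
        PSub s.1.2 s'.1.2 ∧ s.1.1 ≤ s'.1.1 ∧ (ξ < l → ξ ≤ s'.1.1) := by
    intro s ξ
    by_cases hξ : ξ < l ∧ s.1.1 ≤ ξ
    · obtain ⟨B', hB', hs⟩ := ih ξ hξ.1 _ _ s.2.1 hξ.2
      exact ⟨⟨(ξ, B'), hB', hξ.1⟩, hs, hξ.2, fun _ => le_rfl⟩
    · exact ⟨s, fun _ _ h => h, le_rfl, fun h => (not_le.1 fun h' => hξ ⟨h, h'⟩).le⟩
  choose next hnext₁ hnext₂ hnext₃ using step
  let s : ℕ → {s : Ordinal.{u} × (BinSeq.{u} →. BinSeq.{u}) // p.Raise g s.1 s.2 ∧ s.1 < l} :=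
    fun n => Nat.rec ⟨(m, B), hm, hml⟩ (fun i s => next s (e i)) n
  have hr : ∀ n, p.Raise g (s n).1.1 (s n).1.2 := fun n => (s n).2.1
  have hsub : ∀ i j, i ≤ j → PSub (s i).1.2 (s j).1.2 := by
    intro i j hij
    induction j, hij using Nat.le_induction with
    | base => exact fun _ _ h => h
    | succ j _ ih' => exact fun x y h => hnext₁ (s j) (e j) x y (ih' x y h)
  have hcof : ∀ ξ < l, ∃ n, ξ < (s n).1.1 := by
    intro ξ hξ
    obtain ⟨n, hn⟩ := he (hlim ξ hξ)
    refine ⟨n + 1, (lt_add_one ξ).trans_le ?_⟩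
    rw [← hn]
    exact hnext₃ (s n) (e n) (hn ▸ hlim ξ hξ)
  have hcoh : ∀ i j, ∀ x ∈ p.t, x.length ≤ (s i).1.1 → x.length ≤ (s j).1.1 →
      (s i).1.2 x = (s j).1.2 x := by
    intro i j x hx hi hj
    rcases le_total i j with h | h
    · exact (hsub i j h).eq_of_mem_dom ((hr i).mem_dom hx hi)
    · exact ((hsub j i h).eq_of_mem_dom ((hr j).mem_dom hx hj)).symm
  have hBs : ∀ n, PSub B (s n).1.2 := fun n => hsub 0 n (Nat.zero_le n)
  generalize hM : (fun n => (s n).1.1) = M at *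
  generalize hC : (fun n => (s n).1.2) = C at *
  have hMn : ∀ n, (s n).1.1 = M n := fun n => congrFun hM n
  have hCn : ∀ n, (s n).1.2 = C n := fun n => congrFun hC n
  simp only [hMn, hCn] at *
  -- arbitrary values
  have hE : ∃ E : BinSeq.{u} →. BinSeq.{u}, E.Dom = p.t ∧
      ∀ x, ∀ y ∈ E x, ∀ T ∈ p.k x, y ∈ level T x.length := by
    have : ∀ x ∈ p.t, ∃ y, ∀ T ∈ p.k x, y ∈ level T x.length := by
      intro x hx
      obtain ⟨T, hT⟩ := p.exists_k hx
      obtain ⟨y, hy⟩ := level_nonempty (T := T) (α := x.length)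
        (by rw [(p.k_tree x T hT).2]; exact lt_add_one _)
      exact ⟨y, fun T' hT' => by rwa [Part.mem_unique hT' hT]⟩
    choose E hE using this
    refine ⟨fun x => ⟨x ∈ p.t, E x⟩, rfl, ?_⟩
    rintro x y ⟨hx, rfl⟩ T hT
    exact hE x hx T hT
  obtain ⟨E, hEdom, hEmem⟩ := hE
  -- the indices of the functions to be followed over the node `y` of level `m`
  let S : BinSeq.{u} → Set Ordinal.{u} := fun y =>
    {γ | γ ∈ p.U ∧ γ ≠ g ∧ l ≤ p.β γ ∧ p.b γ y = B y}
  let D : BinSeq.{u} →. BinSeq.{u} := fun x =>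
    if x.length ≤ m then B x else if l < x.length then Part.none
      else if h : (S (x.restrict m)).Nonempty then p.b h.some x
      else if h : x.length < l then C (hcof x.length h).choose x else E x
  have D_low : ∀ x, x.length ≤ m → D x = B x := fun x hx => if_pos hx
  have D_high : ∀ x, l < x.length → D x = Part.none := fun x hx => by
    simp only [D]
    rw [if_neg (hml.trans hx).not_ge, if_pos hx]
  have D_follow : ∀ y, y.length = m → (S y).Nonempty → ∃ γ ∈ S y, ∀ x, y ≤ x → x.length ≤ l →
      D x = p.b γ x := by
    intro y hy hS
    refine ⟨hS.some, hS.some_mem, fun x hyx hxl => ?_⟩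
    rcases hyx.lt_or_eq with h | rfl
    · have hlt : m < x.length := hy ▸ (lt_iff_length.1 h).2
      have hres : x.restrict m = y := by rw [← hy]; exact restrict_eq_of_le hyx
      simp only [D]
      rw [if_neg hlt.not_ge, if_neg hxl.not_gt]
      subst hres
      rw [dif_pos hS]
    · rw [D_low y hy.le]
      exact hS.some_mem.2.2.2.symm
  have D_chain : ∀ y, y.length = m → ¬ (S y).Nonempty → ∀ x ∈ p.t, y ≤ x → x.length < l →
      ∀ n, x.length ≤ M n → D x = C n x := by
    intro y hy hS x hx hyx hxl n hn
    rcases hyx.lt_or_eq with h | rfl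
    · have hlt : m < x.length := hy ▸ (lt_iff_length.1 h).2
      have hres : x.restrict m = y := by rw [← hy]; exact restrict_eq_of_le hyx
      simp only [D]
      rw [if_neg hlt.not_ge, if_neg hxl.not_gt, hres, dif_neg hS, dif_pos hxl]
      exact hcoh _ _ x hx (hcof x.length hxl).choose_spec.le hn
    · rw [D_low y hy.le]
      exact (hBs n).eq_of_mem_dom (hm.mem_dom hx hy.le)
  have D_top : ∀ y, y.length = m → ¬ (S y).Nonempty → ∀ x, y ≤ x → x.length = l →
      D x = E x := by
    intro y hy hS x hyx hxl
    have hlt : m < x.length := hxl ▸ hml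
    have hres : x.restrict m = y := by rw [← hy]; exact restrict_eq_of_le hyx
    simp only [D]
    rw [if_neg hlt.not_ge, if_neg hxl.le.not_gt, hres, dif_neg hS, dif_neg hxl.ge.not_gt]
  -- the value of `D` comes from a function with the right domain and values
  have D_cases : ∀ x, x.length ≤ l → ∃ F : BinSeq.{u} →. BinSeq.{u}, D x = F x ∧
      (x ∈ F.Dom ↔ x ∈ p.t) ∧ ∀ y ∈ F x, ∀ T ∈ p.k x, y ∈ level T x.length := by
    intro x hxl
    rcases le_or_gt x.length m with hxm | hxm
    · refine ⟨B, D_low x hxm, ?_, hm.mem x⟩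
      rw [hm.dom, p.mem_below_iff, and_iff_left hxm]
    · have hy := length_restrict hxm.le
      by_cases hS : (S (x.restrict m)).Nonempty
      · obtain ⟨γ, hγ, h⟩ := D_follow _ hy hS
        refine ⟨p.b γ, h x (restrict_le _ _) hxl, ?_, p.b_mem γ hγ.1 x⟩
        rw [p.b_dom γ hγ.1, p.mem_below_iff, and_iff_left (hxl.trans hγ.2.2.1)]
      · by_cases hxt : x ∈ p.t
        · rcases hxl.lt_or_eq with hlt | heq
          · obtain ⟨n, hn⟩ := hcof _ hlt
            refine ⟨C n, D_chain _ hy hS x hxt (restrict_le _ _) hlt n hn.le, ?_, (hr n).mem x⟩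
            rw [(hr n).dom, p.mem_below_iff, and_iff_left hn.le]
          · exact ⟨E, D_top _ hy hS x (restrict_le _ _) heq, by rw [hEdom], hEmem x⟩
        · rcases hxl.lt_or_eq with hlt | heq
          · refine ⟨C (hcof x.length hlt).choose, ?_, ?_, (hr _).mem x⟩
            · simp only [D]
              rw [if_neg hxm.not_ge, if_neg hxl.not_gt, dif_neg hS, dif_pos hlt]
            · rw [(hr _).dom, p.mem_below_iff, and_iff_left (hcof x.length hlt).choose_spec.le]
          · exact ⟨E, D_top _ hy hS x (restrict_le _ _) heq, by rw [hEdom], hEmem x⟩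
  have D_mem_t : ∀ x y, y ∈ D x → x ∈ p.t ∧ x.length ≤ l := by
    intro x y hy
    rcases le_or_gt x.length l with hxl | hxl
    · obtain ⟨F, hF, hdom, -⟩ := D_cases x hxl
      exact ⟨hdom.1 ((PFun.mem_dom F x).2 ⟨y, hF ▸ hy⟩), hxl⟩
    · rw [D_high x hxl] at hy
      exact absurd hy (Part.notMem_none y)
  have D_mono_above : ∀ z, z.length = m → ∀ x x' y y', y ∈ D x → y' ∈ D x' → z ≤ x → x ≤ x' →
      x'.length < l → y ≤ y' := by
    intro z hz x x' y y' hy hy' hzx hxx' hl'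
    by_cases hS : (S z).Nonempty
    · obtain ⟨γ, hγ, h⟩ := D_follow z hz hS
      rw [h x hzx (hxx'.1.trans hl'.le)] at hy
      rw [h x' (hzx.trans hxx') hl'.le] at hy'
      exact p.b_mono' hy hy' hxx' (hl'.trans_le hγ.2.2.1)
    · obtain ⟨n, hn⟩ := hcof _ hl'
      rw [D_chain z hz hS x (D_mem_t x y hy).1 hzx (hxx'.1.trans_lt hl') n
        (hxx'.1.trans hn.le)] at hy
      rw [D_chain z hz hS x' (D_mem_t x' y' hy').1 (hzx.trans hxx') hl' n hn.le] at hy'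
      exact (hr n).mono x x' y y' hy hy' hxx' hn
  have D_mono_below : ∀ x x' y y', y ∈ D x → y' ∈ D x' → x ≤ x' → x'.length ≤ m → y ≤ y' := by
    intro x x' y y' hy hy' hxx' hl'
    obtain ⟨n, hn⟩ := hcof m hml
    rw [D_low x (hxx'.1.trans hl')] at hy
    rw [D_low x' hl'] at hy'
    exact (hr n).mono x x' y y' (hBs n _ _ hy) (hBs n _ _ hy') hxx' (hl'.trans_lt hn)
  have D_cons_above : ∀ x ∈ p.t, m ≤ x.length → ∀ V ⊆ p.U, g ∉ V → V.Finite → ∀ ε,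
      x.length < ε → ε ≤ l → ∃ x' ∈ level p.t ε, x < x' ∧ p.ConservesWith D V x x' := by
    intro x hx hxm V hV hgV hfin ε hxε hε
    have hz : (x.restrict m).length = m := length_restrict hxm
    have hzx : x.restrict m ≤ x := restrict_le x m
    have hzt := p.t_tree.isLowerSet hzx hx
    have hxl := hxε.trans_le hε
    by_cases hS : (S (x.restrict m)).Nonempty
    · obtain ⟨γ₀, hγ₀, h⟩ := D_follow _ hz hS
      obtain ⟨x', hx', hxx', hc⟩ := p.exists_conserves hx (V := insert γ₀ V)
        (insert_subset hγ₀.1 hV) (hfin.insert γ₀) hxε (hε.trans hl)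
      refine ⟨x', hx', hxx', hc.mono (subset_insert _ _), fun γ hγ hγl he => ?_⟩
      rw [h x hzx hxl.le] at he
      rw [h x' (hzx.trans hxx'.le) (hx'.2.trans_le hε)]
      exact hc γ (Or.inr hγ) γ₀ (Or.inl rfl) hγl (by rw [hx'.2]; exact hε.trans hγ₀.2.2.1) he
    rcases hε.lt_or_eq with hlt | rfl
    · obtain ⟨n, hn⟩ := hcof ε hlt
      obtain ⟨x', hx', hxx', hc⟩ := (hr n).conservative x hx V hV hgV hfin ε hxε hn.le
      exact ⟨x', hx', hxx', hc.congr
        (D_chain _ hz hS x hx hzx hxl n (hxε.le.trans hn.le))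
        (D_chain _ hz hS x' hx'.1 (hzx.trans hxx'.le) (hx'.2.trans_lt hlt) n
          (hx'.2.trans_le hn.le))⟩
    · -- no function that reaches level `l` takes the value of `D` at `x`
      obtain ⟨x', hx', hxx', hc⟩ := p.exists_conserves hx hV hfin hxε hl
      refine ⟨x', hx', hxx', hc, fun γ hγ hγl he => absurd ?_ hS⟩
      rw [hx'.2] at hγl
      obtain ⟨n, hn⟩ := hcof _ hxl
      rw [D_chain _ hz hS x hx hzx hxl n hn.le] at he
      obtain ⟨v, hv⟩ := p.exists_b (hV hγ) hzt (hzx.1.trans (hxl.le.trans hγl))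
      obtain ⟨v', hv'⟩ := hm.exists_mem hzt hz.le
      obtain ⟨w, hw⟩ := p.exists_b (hV hγ) hx (hxl.le.trans hγl)
      have h₁ : v ≤ w := p.b_mono' hv hw hzx (hxl.trans_le hγl)
      have h₂ : v' ≤ w := (hr n).mono _ x v' w (hBs n _ _ hv') (he ▸ hw) hzx hn
      have hvv : v = v' := eq_of_le_of_le h₁ h₂ ((p.length_b hv).trans (hm.length hv').symm)
      refine ⟨γ, hV hγ, fun e => hgV (e ▸ hγ), hγl, ?_⟩
      rw [Part.eq_some_iff.2 hv, Part.eq_some_iff.2 hv', hvv]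
  refine ⟨D, ⟨hm.β_le.trans hml.le, hl, ?_, ?_, ?_, ?_, ?_⟩, ?_⟩
  · intro x y hy
    rw [D_low x ((p.mem_t_of_b hy).2.trans hm.β_le)]
    exact hm.sub x y hy
  · ext x
    rw [p.mem_below_iff]
    constructor
    · intro hx
      obtain ⟨y, hy⟩ := (PFun.mem_dom D x).1 hx
      exact D_mem_t x y hy
    · rintro ⟨hx, hxl⟩
      obtain ⟨F, hF, hdom, -⟩ := D_cases x hxl
      obtain ⟨y, hy⟩ := (PFun.mem_dom F x).1 (hdom.2 hx)
      exact (PFun.mem_dom D x).2 ⟨y, by rw [hF]; exact hy⟩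
  · intro x y hy T hT
    obtain ⟨F, hF, -, hmem⟩ := D_cases x (D_mem_t x y hy).2
    exact hmem y (hF ▸ hy) T hT
  · intro x x' y y' hy hy' hxx' hl'
    rcases le_or_gt x'.length m with h' | h'
    · exact D_mono_below x x' y y' hy hy' hxx' h'
    · have hz : (x'.restrict m).length = m := length_restrict h'.le
      have hzx : x'.restrict m ≤ x' := restrict_le x' m
      rcases le_total x.length m with h | h
      · obtain ⟨v, hv⟩ := hm.exists_mem (p.t_tree.isLowerSet hzx (D_mem_t x' y' hy').1) hz.le
        rw [← D_low _ hz.le] at hv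
        exact (D_mono_below x _ y v hy hv (le_restrict hxx' h) hz.le).trans
          (D_mono_above _ hz _ x' v y' hv hy' le_rfl hzx hl')
      · exact D_mono_above _ hz x x' y y' hy hy' (le_of_le_of_le hzx hxx' (hz.trans_le h)) hxx' hl'
  · intro x hx V hV hgV hfin ε hxε hε
    rcases le_or_gt m x.length with hxm | hxm
    · exact D_cons_above x hx hxm V hV hgV hfin ε hxε hε
    rcases le_or_gt ε m with hεm | hεm
    · obtain ⟨x', hx', hxx', hc⟩ := hm.conservative x hx V hV hgV hfin ε hxε hεm
      exact ⟨x', hx', hxx', hc.congr (D_low x hxm.le) (D_low x' (hx'.2.trans_le hεm))⟩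
    · obtain ⟨z, hz, hxz, hc⟩ := hm.conservative x hx V hV hgV hfin m hxm le_rfl
      obtain ⟨x', hx', hzx', hc'⟩ := D_cons_above z hz.1 hz.2.ge V hV hgV hfin ε
        (hz.2.trans_lt hεm) hε
      exact ⟨x', hx', hxz.trans hzx',
        (hc.congr (D_low x hxm.le) (D_low z hz.2.le)).trans hc' hzx'.le⟩
  · intro x y hy
    rw [D_low x (hm.mem_t hy).2]
    exact hy

/-- Each function `b g` of a condition can be extended to the whole tree, or to a level beyond which
no stronger condition extends it. The second case cannot be avoided, since the value of `b g` at
its last level need not extend the earlier values. -/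
theorem exists_raise (p : Cond κ) (hg : g ∈ p.U) :
    ∃ q ≤ p, q.α = p.α ∧ (q.β g = p.α ∨ ∀ r ≤ q, r.β g ≤ q.β g) := by
  by_contra hcon
  push Not at hcon
  have hnext : ∀ m B, p.Raise g m B → m < p.α →
      ∃ B', p.Raise g (m + 1) B' ∧ PSub B B' := by
    intro m B hB hm
    obtain ⟨-, r, hr, hlt⟩ := hcon _ (update_le hg hB) rfl
    rw [update_β] at hlt
    exact hB.trans_le hg hr (lt_add_one m).le (Order.add_one_le_iff.2 hm)
      (Order.add_one_le_iff.2 hlt)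
  have key : ∀ l ≤ p.α, ∀ m B, p.Raise g m B → m ≤ l → ∃ B', p.Raise g l B' ∧ PSub B B' := by
    intro l
    induction l using WellFoundedLT.induction with
    | ind l ih =>
    intro hl m B hB hml
    rcases hml.eq_or_lt with rfl | hml
    · exact ⟨B, hB, fun _ _ h => h⟩
    by_cases hlim : ∀ ξ < l, ξ + 1 < l
    · exact hB.exists_limit hml hl hlim fun m' hm' n B' h hn =>
        ih m' hm' (hm'.le.trans hl) n B' h hn
    · push Not at hlim
      obtain ⟨ξ, hξ, hle⟩ := hlim
      obtain rfl : l = ξ + 1 := le_antisymm hle (Order.add_one_le_iff.2 hξ)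
      obtain ⟨B₁, h₁, hs₁⟩ := ih ξ hξ (hξ.le.trans hl) m B hB (Order.lt_add_one_iff.1 hml)
      obtain ⟨B₂, h₂, hs₂⟩ := hnext ξ B₁ h₁ (hξ.trans_le hl)
      exact ⟨B₂, h₂, fun x y h => hs₂ x y (hs₁ x y h)⟩
  obtain ⟨B, hB, -⟩ := key p.α le_rfl _ _ (raise_self hg) (p.β_le g hg)
  exact (hcon _ (update_le hg hB) rfl).1 (update_β hg hB)

end raise

end Cond

/-! ### Lower bounds of decreasing sequences of conditions -/

/-- The partial function with graph `R`, for a single-valued relation `R`. -/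
noncomputable def ofRel {A B : Type*} (R : A → B → Prop) : A →. B :=
  fun a => ⟨∃ y, R a y, fun h => h.choose⟩

theorem mem_ofRel {A B : Type*} {R : A → B → Prop} (hR : ∀ a y y', R a y → R a y' → y = y')
    {a : A} {y : B} : y ∈ ofRel R a ↔ R a y := by
  constructor
  · rintro ⟨h, rfl⟩
    exact h.choose_spec
  · exact fun h => ⟨⟨y, h⟩, hR a _ _ (Exists.choose_spec (⟨y, h⟩ : ∃ y, R a y)) h⟩

namespace Cond

variable {κ : Cardinal.{u}}

/-- The supremum of the heights `α` along a sequence of conditions. -/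
noncomputable def limitHeight (q : ℕ → Cond κ) : Ordinal.{u} := ⨆ n, (q n).α

/-- The domains of the functions `b γ` reach arbitrarily high along the sequence. -/
def Active (q : ℕ → Cond κ) (γ : Ordinal.{u}) : Prop := ∀ n, ∃ m, (q n).α ≤ (q m).β γ

/-- `w` is a cofinal branch of the union of the trees of a sequence of conditions. -/
def IsBranch (q : ℕ → Cond κ) (w : BinSeq.{u}) : Prop :=
  w.length = limitHeight q ∧ ∀ n, w.restrict (q n).α ∈ (q n).t

/-- Some (equivalently, all large) conditions of the sequence have `b γ₁ x = b γ₂ x`, with both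
sides defined. -/
def Agree (q : ℕ → Cond κ) (γ₁ γ₂ : Ordinal.{u}) (x : BinSeq.{u}) : Prop :=
  ∃ y, (∃ n, y ∈ (q n).b γ₁ x) ∧ ∃ n, y ∈ (q n).b γ₂ x

variable {q : ℕ → Cond κ}

theorem isLUB_limitHeight (q : ℕ → Cond κ) : IsLUB (range fun n => (q n).α) (limitHeight q) :=
  isLUB_ciSup Ordinal.bddAbove_of_small

theorem limitHeight_lt (q : ℕ → Cond κ) : limitHeight q < Ordinal.omega 1 :=
  Ordinal.iSup_lt_omega_one fun n => (q n).α_lt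

theorem exists_lt_α {ξ : Ordinal.{u}} (hξ : ξ < limitHeight q) : ∃ n, ξ < (q n).α := by
  obtain ⟨_, ⟨n, rfl⟩, hn⟩ := (lt_isLUB_iff (isLUB_limitHeight q)).1 hξ
  exact ⟨n, hn⟩

theorem α_lt_limitHeight (hα : StrictMono fun n => (q n).α) (n : ℕ) : (q n).α < limitHeight q :=
  (hα (Nat.lt_succ_self n)).trans_le ((isLUB_limitHeight q).1 ⟨_, rfl⟩)

theorem mem_b_of_le (hq : Antitone q) {m n : ℕ} (hmn : m ≤ n) {γ : Ordinal.{u}}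
    {x y : BinSeq.{u}} (h : y ∈ (q m).b γ x) : y ∈ (q n).b γ x := mem_b (hq hmn) h

theorem b_unique (hq : Antitone q) {m n : ℕ} {γ : Ordinal.{u}} {x y y' : BinSeq.{u}}
    (h : y ∈ (q m).b γ x) (h' : y' ∈ (q n).b γ x) : y = y' :=
  Part.mem_unique (mem_b_of_le hq (le_max_left m n) h) (mem_b_of_le hq (le_max_right m n) h')

theorem mem_k_of_le (hq : Antitone q) {m n : ℕ} (hmn : m ≤ n) {x : BinSeq.{u}}
    {T : Set BinSeq.{u}} (h : T ∈ (q m).k x) : T ∈ (q n).k x := Stronger.k_sub (hq hmn) x T h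

theorem k_unique (hq : Antitone q) {m n : ℕ} {x : BinSeq.{u}} {T T' : Set BinSeq.{u}}
    (h : T ∈ (q m).k x) (h' : T' ∈ (q n).k x) : T = T' :=
  Part.mem_unique (mem_k_of_le hq (le_max_left m n) h) (mem_k_of_le hq (le_max_right m n) h')

theorem mem_f_of_le (hq : Antitone q) {m n : ℕ} (hmn : m ≤ n) {γ ξ η : Ordinal.{u}}
    (h : η ∈ (q m).f γ ξ) : η ∈ (q n).f γ ξ :=
  Stronger.f_sub (hq hmn) γ ((q m).mem_U_of_f h) ξ η h

theorem exists_b_of_le (hq : Antitone q) {i j k : ℕ} {γ : Ordinal.{u}} {x : BinSeq.{u}}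
    (hγ : γ ∈ (q i).U) (hx : x ∈ (q j).t) (hl : x.length ≤ (q k).β γ) :
    ∀ n, i ≤ n → j ≤ n → k ≤ n → ∃ y, y ∈ (q n).b γ x := fun n hi hj hk =>
  (q n).exists_b (Stronger.U_sub (hq hi) hγ) (t_subset (hq hj) hx)
    (hl.trans (β_mono_all (hq hk) γ))

theorem b_le_b (hq : Antitone q) {m n k : ℕ} {γ : Ordinal.{u}} {x x' y y' : BinSeq.{u}}
    (h : y ∈ (q m).b γ x) (h' : y' ∈ (q n).b γ x') (hxx' : x ≤ x')
    (hl : x'.length < (q k).β γ) : y ≤ y' := by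
  have hm : m ≤ max m (max n k) := le_max_left _ _
  have hn : n ≤ max m (max n k) := (le_max_left _ _).trans (le_max_right _ _)
  have hk : k ≤ max m (max n k) := (le_max_right _ _).trans (le_max_right _ _)
  exact b_mono' _ (mem_b_of_le hq hm h) (mem_b_of_le hq hn h') hxx'
    (hl.trans_le (β_mono_all (hq hk) γ))

theorem Active.exists_lt_β {γ : Ordinal.{u}} (h : Active q γ) {ξ : Ordinal.{u}}
    (hξ : ξ < limitHeight q) : ∃ m, ξ < (q m).β γ := by
  obtain ⟨n, hn⟩ := exists_lt_α hξ
  obtain ⟨m, hm⟩ := h n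
  exact ⟨m, hn.trans_le hm⟩

theorem Active.exists_mem_U (hα : StrictMono fun n => (q n).α) {γ : Ordinal.{u}}
    (h : Active q γ) : ∃ n, γ ∈ (q n).U := by
  obtain ⟨m, hm⟩ := h 1
  refine ⟨m, ?_⟩
  by_contra hγ
  rw [(q m).β_off γ hγ] at hm
  have h01 : (q 0).α < (q 1).α := hα Nat.zero_lt_one
  exact not_lt_zero (h01.trans_le hm)

theorem countable_active (hq : Antitone q) (hα : StrictMono fun n => (q n).α) :
    {γ | Active q γ}.Countable := by
  have : {γ | Active q γ} ⊆ ⋃ n, ⋃ m, {γ | γ ∈ (q n).U ∧ n ≤ m ∧ (q n).β γ < (q m).β γ} := by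
    intro γ (hγ : Active q γ)
    obtain ⟨n, hn⟩ := hγ.exists_mem_U hα
    obtain ⟨m, hm⟩ := hγ.exists_lt_β (α_lt_limitHeight hα n)
    refine mem_iUnion.2 ⟨n, mem_iUnion.2 ⟨max n m, hn, le_max_left _ _, ?_⟩⟩
    exact (((q n).β_le γ hn).trans_lt hm).trans_le (β_mono_all (hq (le_max_right n m)) γ)
  refine (countable_iUnion fun n => countable_iUnion fun m => ?_).mono this
  by_cases hnm : n ≤ m
  · refine (Stronger.β_countable (hq hnm)).mono ?_
    rintro γ ⟨h₁, -, h₂⟩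
    exact ⟨h₁, h₂⟩
  · refine countable_empty.mono ?_
    rintro γ ⟨-, h, -⟩
    exact hnm h

section branch

variable {w : BinSeq.{u}}

theorem IsBranch.exists_restrict (hw : IsBranch q w) {x : BinSeq.{u}} (hx : x < w) :
    ∃ n, x < w.restrict (q n).α := by
  obtain ⟨n, hn⟩ := exists_lt_α (hw.1 ▸ (lt_iff_length.1 hx).2)
  refine ⟨n, lt_iff_length.2 ⟨le_restrict hx.le hn.le, lt_min (lt_iff_length.1 hx).2 hn⟩⟩

theorem IsBranch.length_restrict (hα : StrictMono fun n => (q n).α) (hw : IsBranch q w) (n : ℕ) :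
    (w.restrict (q n).α).length = (q n).α :=
  BinSeq.length_restrict (hw.1 ▸ (α_lt_limitHeight hα n).le)

theorem IsBranch.restrict_lt (hα : StrictMono fun n => (q n).α) (hw : IsBranch q w) (n : ℕ) :
    w.restrict (q n).α < w :=
  BinSeq.restrict_lt (hw.1 ▸ α_lt_limitHeight hα n)

theorem IsBranch.restrict_lt_restrict (hα : StrictMono fun n => (q n).α) (hw : IsBranch q w)
    {m n : ℕ} (hmn : m < n) : w.restrict (q m).α < w.restrict (q n).α := by
  have hlt : (w.restrict (q m).α).length < (w.restrict (q n).α).length := by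
    rw [hw.length_restrict hα, hw.length_restrict hα]
    exact hα hmn
  exact lt_iff_length.2 ⟨le_of_le_of_le (restrict_le _ _) (restrict_le _ _) hlt.le, hlt⟩

theorem Active.exists_b (hq : Antitone q) (hα : StrictMono fun n => (q n).α) {γ : Ordinal.{u}}
    (hγ : Active q γ) {n : ℕ} {x : BinSeq.{u}} (hx : x ∈ (q n).t) : ∃ m y, y ∈ (q m).b γ x := by
  obtain ⟨i, hi⟩ := hγ.exists_mem_U hα
  obtain ⟨k, hk⟩ := hγ n
  exact ⟨_, exists_b_of_le hq hi hx (((q n).length_le hx).trans hk) (max i (max n k))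
    (le_max_left _ _) ((le_max_left _ _).trans (le_max_right _ _))
    ((le_max_right _ _).trans (le_max_right _ _))⟩

/-- The values of an active function along a cofinal branch have a union. -/
theorem IsBranch.exists_value (hq : Antitone q) (hα : StrictMono fun n => (q n).α)
    (hw : IsBranch q w) {γ : Ordinal.{u}} (hγ : Active q γ) :
    ∃ d : BinSeq.{u}, d.length = limitHeight q ∧
      ∀ n, ∀ x < w, ∀ y ∈ (q n).b γ x, y ≤ d := by
  choose N c hc using fun n => hγ.exists_b hq hα (hw.2 n)
  have hmono : ∀ {m n : ℕ} {x x' y y' : BinSeq.{u}}, y ∈ (q m).b γ x → y' ∈ (q n).b γ x' →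
      x ≤ x' → y ≤ y' := by
    intro m n x x' y y' h h' hxx'
    obtain ⟨k, hk⟩ := hγ.exists_lt_β
      (((q n).length_le ((q n).mem_t_of_b h').1).trans_lt (α_lt_limitHeight hα n))
    exact b_le_b hq h h' hxx' hk
  obtain ⟨d, hd, hcd⟩ := exists_union (c := c)
    (monotone_nat_of_le_succ fun n => hmono (hc n) (hc (n + 1))
      (hw.restrict_lt_restrict hα (Nat.lt_succ_self n)).le) (limitHeight_lt q) (fun n => by
        rw [(q _).length_b (hc n), hw.length_restrict hα]
        exact (α_lt_limitHeight hα n).le)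
  refine ⟨d, hd, fun n x hx y hy => ?_⟩
  obtain ⟨m, hm⟩ := hw.exists_restrict hx
  exact (hmono hy (hc m) hm.le).trans (hcd m)

theorem IsBranch.value_eq (hα : StrictMono fun n => (q n).α)
    (hw : IsBranch q w) {γ₁ γ₂ : Ordinal.{u}} {d₁ d₂ : BinSeq.{u}}
    (h₁ : d₁.length = limitHeight q) (h₂ : d₂.length = limitHeight q)
    (hd₁ : ∀ n, ∀ x < w, ∀ y ∈ (q n).b γ₁ x, y ≤ d₁)
    (hd₂ : ∀ n, ∀ x < w, ∀ y ∈ (q n).b γ₂ x, y ≤ d₂) {n : ℕ}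
    (h : ∀ m ≥ n, Agree q γ₁ γ₂ (w.restrict (q m).α)) : d₁ = d₂ := by
  refine eq_of_common_segments h₁ h₂ fun ξ hξ => ?_
  obtain ⟨m, hm⟩ := exists_lt_α hξ
  obtain ⟨y, ⟨i, hi⟩, ⟨j, hj⟩⟩ := h (max n m) (le_max_left _ _)
  have hlt := hw.restrict_lt hα (max n m)
  refine ⟨y, hd₁ i _ hlt y hi, hd₂ j _ hlt y hj, ?_⟩
  rw [(q i).length_b hi, hw.length_restrict hα]
  exact hm.trans_le (hα.monotone (le_max_right n m))

/-- The trees assigned to the nodes of a cofinal branch have a common end-extension of the right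
height, which contains countably many prescribed cofinal branches. -/
theorem IsBranch.exists_tree (hq : Antitone q) (hα : StrictMono fun n => (q n).α)
    (hw : IsBranch q w) {D : Set BinSeq.{u}} (hD : D.Countable)
    (hDw : ∀ d ∈ D, ∃ γ, Active q γ ∧ d.length = limitHeight q ∧
      ∀ n, ∀ x < w, ∀ y ∈ (q n).b γ x, y ≤ d) :
    ∃ T, IsCountableNormalTree T ∧ height T = limitHeight q + 1 ∧
      (∀ n, ∀ x < w, ∀ S ∈ (q n).k x, EndExt S T) ∧ D ⊆ T := by
  choose S hS using fun n => (q n).exists_k (hw.2 n)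
  have hSn : ∀ n, IsCountableNormalTree (S n) := fun n => ((q n).k_tree _ _ (hS n)).1
  have hSh : ∀ n, height (S n) = (q n).α + 1 := fun n => by
    rw [((q n).k_tree _ _ (hS n)).2, hw.length_restrict hα]
  obtain ⟨T, hT, hTh, hTe, hDT⟩ := exists_limit_tree (T := S) hα (isLUB_limitHeight q)
    (limitHeight_lt q) hSn hSh
    (fun n => (q (n + 1)).k_endExt _ _ (hw.restrict_lt_restrict hα (Nat.lt_succ_self n)) _
      (mem_k_of_le hq (Nat.le_succ n) (hS n)) _ (hS (n + 1))) hD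
    (fun d hd => by
      obtain ⟨γ, -, h, -⟩ := hDw d hd
      exact h)
    (fun d hd z hz => by
      obtain ⟨γ, hγ, hdl, hdw⟩ := hDw d hd
      obtain ⟨m, hm⟩ := exists_lt_α (hdl ▸ (lt_iff_length.1 hz).2)
      obtain ⟨i, y, hy⟩ := hγ.exists_b hq hα (hw.2 m)
      have hyd := hdw i _ (hw.restrict_lt hα m) y hy
      have hyl : y.length = (q m).α := by
        rw [(q i).length_b hy, hw.length_restrict hα]
      have hyS := (q (max i m)).b_mem γ
        ((q _).mem_U_of_b (mem_b_of_le hq (le_max_left i m) hy)) _ y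
        (mem_b_of_le hq (le_max_left i m) hy) _ (mem_k_of_le hq (le_max_right i m) (hS m))
      exact ⟨m, (hSn m).isLowerSet (le_of_le_of_le hz.le hyd (hyl ▸ hm.le)) hyS.1⟩)
  refine ⟨T, hT, hTh, fun n x hx S' hS' => ?_, hDT⟩
  obtain ⟨m, hm⟩ := hw.exists_restrict hx
  obtain ⟨h₁, h₂⟩ := (q n).k_tree x S' hS'
  refine EndExt.trans h₁.isLowerSet h₂ (hSh m) ?_ ((q (max n m)).k_endExt _ _ hm _
    (mem_k_of_le hq (le_max_left n m) hS') _ (mem_k_of_le hq (le_max_right n m) (hS m))) (hTe m)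
  rw [← hw.length_restrict hα m]
  exact hm.le.1

/-- Below each node of the union of the trees there is a cofinal branch along which finitely many
active functions satisfy all the equalities that they satisfy at that node. -/
theorem exists_conservative_branch (hq : Antitone q) (hα : StrictMono fun n => (q n).α)
    {n : ℕ} {x : BinSeq.{u}} (hx : x ∈ (q n).t) {V : Set Ordinal.{u}} (hV : V.Finite)
    (hact : ∀ γ ∈ V, Active q γ) :
    ∃ w, IsBranch q w ∧ x < w ∧ ∃ n, ∀ γ₁ ∈ V, ∀ γ₂ ∈ V, Agree q γ₁ γ₂ x →
      ∀ m ≥ n, Agree q γ₁ γ₂ (w.restrict (q m).α) := by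
  have step : ∀ n, ∀ x ∈ (q n).t, ∃ y ∈ level (q (n + 1)).t (q (n + 1)).α, x < y ∧
      ∀ γ₁ ∈ V, ∀ γ₂ ∈ V, Agree q γ₁ γ₂ x → Agree q γ₁ γ₂ y := by
    intro n x hx
    have hev : ∀ᶠ i in Filter.atTop, ∀ γ ∈ V, γ ∈ (q i).U ∧ (q (n + 1)).α ≤ (q i).β γ := by
      refine (Filter.eventually_all_finite hV).2 fun γ hγ => ?_
      obtain ⟨i, hi⟩ := (hact γ hγ).exists_mem_U hα
      obtain ⟨j, hj⟩ := hact γ hγ (n + 1)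
      filter_upwards [Filter.eventually_ge_atTop i, Filter.eventually_ge_atTop j] with k hk hk'
      exact ⟨Stronger.U_sub (hq hk) hi, hj.trans (β_mono_all (hq hk') γ)⟩
    obtain ⟨N, hN, hnN⟩ := (hev.and (Filter.eventually_ge_atTop (n + 1))).exists
    have hxN : x ∈ (q N).t := t_subset (hq ((Nat.le_succ n).trans hnN)) hx
    have hxl : x.length < (q (n + 1)).α := ((q n).length_le hx).trans_lt (hα (Nat.lt_succ_self n))
    obtain ⟨y, hy, hxy, hc⟩ := (q N).exists_conserves hxN (fun γ hγ => (hN γ hγ).1) hV hxl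
      (hα.monotone hnN)
    refine ⟨y, ⟨mem_t_of_le (hq hnN) hy.1 hy.2.le, hy.2⟩, hxy, ?_⟩
    rintro γ₁ h₁ γ₂ h₂ ⟨v, ⟨i, hi⟩, ⟨j, hj⟩⟩
    obtain ⟨v₁, hv₁⟩ := (q N).exists_b (hN γ₁ h₁).1 hxN (hxl.le.trans (hN γ₁ h₁).2)
    obtain ⟨v₂, hv₂⟩ := (q N).exists_b (hN γ₂ h₂).1 hxN (hxl.le.trans (hN γ₂ h₂).2)
    have he : (q N).b γ₁ x = (q N).b γ₂ x := by
      rw [Part.eq_some_iff.2 hv₁, Part.eq_some_iff.2 hv₂, b_unique hq hv₁ hi, b_unique hq hv₂ hj]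
    obtain ⟨z, hz⟩ := (q N).exists_b (hN γ₁ h₁).1 hy.1 (hy.2.trans_le (hN γ₁ h₁).2)
    have he' := hc γ₁ h₁ γ₂ h₂ (hy.2.trans_le (hN γ₁ h₁).2) (hy.2.trans_le (hN γ₂ h₂).2) he
    exact ⟨z, ⟨N, hz⟩, ⟨N, he' ▸ hz⟩⟩
  obtain ⟨y, hy, hxy, hRy⟩ := step n x hx
  obtain ⟨w, hwl, hyw, hwt, hwR⟩ := exists_branch (T := fun n => (q n).t)
    (R := fun x y => ∀ γ₁ ∈ V, ∀ γ₂ ∈ V, Agree q γ₁ γ₂ x → Agree q γ₁ γ₂ y)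
    (isLUB_limitHeight q) (α_lt_limitHeight hα) (limitHeight_lt q)
    (fun n x hx => step n x hx.1) hy
  have hw : IsBranch q w := by
    refine ⟨hwl, fun m => ?_⟩
    rcases le_total (n + 1) m with h | h
    · exact hwt m h
    · have hle : (q m).α ≤ w.length := hwl ▸ (α_lt_limitHeight hα m).le
      refine mem_t_of_le (hq h) ((q (n + 1)).t_tree.isLowerSet ?_ (hwt (n + 1) le_rfl))
        (min_le_right _ _)
      exact le_restrict (restrict_le _ _) ((min_le_right _ _).trans (hα.monotone h))
  refine ⟨w, hw, hxy.trans hyw, n + 1, fun γ₁ h₁ γ₂ h₂ hA m hm => ?_⟩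
  induction m, hm using Nat.le_induction with
  | base =>
    rw [← hy.2, restrict_eq_of_le hyw.le]
    exact hRy γ₁ h₁ γ₂ h₂ hA
  | succ m hm ih => exact hwR m hm γ₁ h₁ γ₂ h₂ ih

end branch

/-- A decreasing sequence of conditions with strictly increasing heights has a lower bound if the
domain of each function `b γ` is eventually constant or cofinal. -/
theorem exists_lower_bound (hq : Antitone q) (hα : StrictMono fun n => (q n).α)
    (hβ : ∀ γ, Active q γ ∨ ∃ n, ∀ m ≥ n, (q m).β γ = (q n).β γ) : ∃ r, ∀ n, r ≤ q n := by
  classical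
  have hlt := α_lt_limitHeight hα
  have hlen : ∀ n, ∀ x ∈ (q n).t, x.length < limitHeight q := fun n x hx =>
    ((q n).length_le hx).trans_lt (hlt n)
  -- the values of the active functions on the last level
  have hval : ∀ γ w, Active q γ → IsBranch q w → ∃ d : BinSeq.{u}, d.length = limitHeight q ∧
      ∀ n, ∀ x < w, ∀ y ∈ (q n).b γ x, y ≤ d :=
    fun γ w hγ hw => hw.exists_value hq hα hγ
  have : Nonempty BinSeq.{u} := 
    ⟨(level_nonempty (T := (q 0).t) (α := 0) (by rw [(q 0).t_height]; simp)).some⟩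
  choose! v hvl hvle using hval
  -- the trees assigned to the nodes of the last level
  have htree : ∀ w, IsBranch q w → ∃ T, IsCountableNormalTree T ∧ height T = limitHeight q + 1 ∧
      (∀ n, ∀ x < w, ∀ S ∈ (q n).k x, EndExt S T) ∧ (fun γ => v γ w) '' {γ | Active q γ} ⊆ T := by
    intro w hw
    refine hw.exists_tree hq hα ((countable_active hq hα).image _) ?_
    rintro _ ⟨γ, hγ, rfl⟩
    exact ⟨γ, hγ, hvl γ w hγ hw, hvle γ w hγ hw⟩
  choose! K hKn hKh hKe hKv using htree
  -- the nodes of the last level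
  have hbranch : ∀ (x : BinSeq.{u}) (V : Set Ordinal.{u}), (∃ n, x ∈ (q n).t) →
      (V.Finite ∧ V ⊆ {γ | Active q γ}) → ∃ w, IsBranch q w ∧ x < w ∧
      ∀ γ₁ ∈ V, ∀ γ₂ ∈ V, Agree q γ₁ γ₂ x → v γ₁ w = v γ₂ w := by
    rintro x V ⟨n, hx⟩ ⟨hV, hact⟩
    obtain ⟨w, hw, hxw, m, hm⟩ := exists_conservative_branch hq hα hx hV hact
    exact ⟨w, hw, hxw, fun γ₁ h₁ γ₂ h₂ hA => hw.value_eq hα (hvl _ _ (hact h₁) hw)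
      (hvl _ _ (hact h₂) hw) (hvle _ _ (hact h₁) hw) (hvle _ _ (hact h₂) hw)
      (hm γ₁ h₁ γ₂ h₂ hA)⟩
  choose! W hWb hWx hWv using hbranch
  let P : Set (BinSeq.{u} × Set Ordinal.{u}) :=
    (⋃ n, (q n).t) ×ˢ {V | V.Finite ∧ V ⊆ {γ | Active q γ}}
  let top : Set BinSeq.{u} := (fun z => W z.1 z.2) '' P
  have htopc : top.Countable := by
    refine ((countable_iUnion fun n => (q n).t_tree.countable).prod ?_).image _
    exact countable_ofPred_finite_subset (countable_active hq hα)
  have htopb : ∀ w ∈ top, IsBranch q w := by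
    rintro _ ⟨⟨x, V⟩, hz, rfl⟩
    exact hWb x V (mem_iUnion.1 hz.1) hz.2
  have htopl : ∀ w ∈ top, w.length = limitHeight q := fun w hw => (htopb w hw).1
  obtain ⟨htn, hth, hte⟩ := limit_tree (T := fun n => (q n).t) hα (isLUB_limitHeight q)
    (fun n => (q n).t_tree) (fun n => (q n).t_height)
    (fun n => Stronger.t_endExt (hq (Nat.le_succ n))) htopc htopl
    (fun w hw x hx => by
      obtain ⟨n, hn⟩ := (htopb w hw).exists_restrict hx
      exact ⟨n, (q n).t_tree.isLowerSet hn.le ((htopb w hw).2 n)⟩)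
    (fun n x hx => ⟨W x ∅, ⟨(x, ∅), ⟨mem_iUnion.2 ⟨n, hx⟩, finite_empty, empty_subset _⟩, rfl⟩,
      hWx x ∅ ⟨n, hx⟩ ⟨finite_empty, empty_subset _⟩⟩)
  have hnottop : ∀ {n x}, x ∈ (q n).t → x ∉ top := fun hx h =>
    (hlen _ _ hx).ne (htopl _ h)
  -- the functions of the lower bound
  let kR : BinSeq.{u} → Set BinSeq.{u} → Prop := fun x T =>
    (∃ n, T ∈ (q n).k x) ∨ (x ∈ top ∧ T = K x)
  have hkR : ∀ x T T', kR x T → kR x T' → T = T' := by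
    rintro x T T' (⟨n, h⟩ | ⟨h, rfl⟩) (⟨m, h'⟩ | ⟨h', rfl⟩)
    · exact k_unique hq h h'
    · exact absurd h' (hnottop ((q n).mem_t_of_k h))
    · exact absurd h (hnottop ((q m).mem_t_of_k h'))
    · rfl
  let bR : Ordinal.{u} → BinSeq.{u} → BinSeq.{u} → Prop := fun γ x y =>
    (∃ n, y ∈ (q n).b γ x) ∨ (Active q γ ∧ x ∈ top ∧ y = v γ x)
  have hbR : ∀ γ x y y', bR γ x y → bR γ x y' → y = y' := by
    rintro γ x y y' (⟨n, h⟩ | ⟨-, h, rfl⟩) (⟨m, h'⟩ | ⟨-, h', rfl⟩)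
    · exact b_unique hq h h'
    · exact absurd h' (hnottop ((q n).mem_t_of_b h).1)
    · exact absurd h (hnottop ((q m).mem_t_of_b h').1)
    · rfl
  let fR : Ordinal.{u} → Ordinal.{u} → Ordinal.{u} → Prop := fun γ ξ η => ∃ n, η ∈ (q n).f γ ξ
  have hfR : ∀ γ ξ η η', fR γ ξ η → fR γ ξ η' → η = η' := by
    rintro γ ξ η η' ⟨n, h⟩ ⟨m, h'⟩
    exact Part.mem_unique (mem_f_of_le hq (le_max_left n m) h)
      (mem_f_of_le hq (le_max_right n m) h')
  have mem_kR : ∀ {x T}, T ∈ ofRel kR x ↔ kR x T := mem_ofRel hkR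
  have mem_bR : ∀ {γ x y}, y ∈ ofRel (bR γ) x ↔ bR γ x y := fun {γ} => mem_ofRel (hbR γ)
  have mem_fR : ∀ {γ ξ η}, η ∈ ofRel (fR γ) ξ ↔ fR γ ξ η := fun {γ} => mem_ofRel (hfR γ)
  -- the domains of the functions `b γ` of the lower bound
  have hβle : ∀ γ n, (q n).β γ ≤ ⨆ n, (q n).β γ := fun γ n =>
    le_ciSup (f := fun n => (q n).β γ) Ordinal.bddAbove_of_small n
  have hβlt : ∀ {γ ξ}, ξ < ⨆ n, (q n).β γ → ∃ n, ξ < (q n).β γ := fun h =>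
    exists_lt_of_lt_ciSup h
  have hβα : ∀ γ n, (q n).β γ ≤ (q n).α := fun γ n => by
    by_cases hγ : γ ∈ (q n).U
    · exact (q n).β_le γ hγ
    · rw [(q n).β_off γ hγ]; exact zero_le
  have hβlim : ∀ γ, ⨆ n, (q n).β γ ≤ limitHeight q := fun γ =>
    ciSup_le fun n => (hβα γ n).trans (hlt n).le
  have hβact : ∀ {γ}, Active q γ → ⨆ n, (q n).β γ = limitHeight q := fun {γ} hγ => by
    refine (hβlim γ).antisymm (le_of_forall_lt fun ξ hξ => ?_)
    obtain ⟨m, hm⟩ := hγ.exists_lt_β hξ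
    exact hm.trans_le (hβle γ m)
  have hβatt : ∀ {γ}, ¬ Active q γ → ∃ n, ⨆ n, (q n).β γ = (q n).β γ := fun {γ} hγ => by
    obtain ⟨n, hn⟩ := (hβ γ).resolve_left hγ
    refine ⟨n, (ciSup_le fun m => ?_).antisymm (hβle γ n)⟩
    rcases le_total n m with h | h
    · exact (hn m h).le
    · exact β_mono_all (hq h) γ
  have hactive : ∀ {γ}, limitHeight q ≤ ⨆ n, (q n).β γ → Active q γ := fun {γ} h => by
    by_contra hγ
    obtain ⟨n, hn⟩ := hβatt hγ
    rw [hn] at h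
    exact (h.trans (hβα γ n)).not_gt (hlt n)
  -- values below the last level are attained along the sequence
  have hreach : ∀ {γ ξ}, ξ < limitHeight q → ξ ≤ ⨆ n, (q n).β γ → ∃ n, ξ ≤ (q n).β γ :=
    fun {γ ξ} hξ hle => by
    by_cases hγ : Active q γ
    · obtain ⟨m, hm⟩ := hγ.exists_lt_β hξ
      exact ⟨m, hm.le⟩
    · obtain ⟨n, hn⟩ := hβatt hγ
      exact ⟨n, hn ▸ hle⟩
  have hbsub : ∀ γ n, PSub ((q n).b γ) (ofRel (bR γ)) := fun γ n x y h => mem_bR.2 (Or.inl ⟨n, h⟩)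
  let r : Cond κ :=
    { α := limitHeight q
      t := (⋃ n, (q n).t) ∪ top
      k := ofRel kR
      U := ⋃ n, (q n).U
      b := fun γ => ofRel (bR γ)
      β := fun γ => ⨆ n, (q n).β γ
      f := fun γ => ofRel (fR γ)
      δ := fun γ => ⨆ n, (q n).δ γ
      α_lt := limitHeight_lt q
      t_tree := htn
      t_height := hth
      k_dom := by
        ext x
        refine (PFun.mem_dom _ x).trans ⟨?_, ?_⟩
        · rintro ⟨T, hT⟩
          rcases mem_kR.1 hT with ⟨n, h⟩ | ⟨h, -⟩
          · exact Or.inl (mem_iUnion.2 ⟨n, (q n).mem_t_of_k h⟩)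
          · exact Or.inr h
        · rintro (h | h)
          · obtain ⟨n, hn⟩ := mem_iUnion.1 h
            obtain ⟨T, hT⟩ := (q n).exists_k hn
            exact ⟨T, mem_kR.2 (Or.inl ⟨n, hT⟩)⟩
          · exact ⟨K x, mem_kR.2 (Or.inr ⟨h, rfl⟩)⟩
      k_tree := by
        intro x T hT
        rcases mem_kR.1 hT with ⟨n, h⟩ | ⟨h, rfl⟩
        · exact (q n).k_tree x T h
        · exact ⟨hKn x (htopb x h), by rw [hKh x (htopb x h), htopl x h]⟩
      k_endExt := by
        intro x y hxy T hT T' hT'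
        have hx : ∃ n, T ∈ (q n).k x := by
          refine (mem_kR.1 hT).resolve_right fun h => ?_
          have hlt' := (lt_iff_length.1 hxy).2
          rw [htopl x h.1] at hlt'
          rcases mem_kR.1 hT' with ⟨n, h'⟩ | ⟨h', -⟩
          · exact hlt'.asymm (hlen n y ((q n).mem_t_of_k h'))
          · exact hlt'.ne' (htopl y h')
        obtain ⟨n, hn⟩ := hx
        rcases mem_kR.1 hT' with ⟨m, h⟩ | ⟨h, rfl⟩
        · exact (q (max n m)).k_endExt x y hxy T (mem_k_of_le hq (le_max_left _ _) hn) T'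
            (mem_k_of_le hq (le_max_right _ _) h)
        · exact hKe y (htopb y h) n x hxy T hn
      U_sub := by
        intro γ hγ
        obtain ⟨n, hn⟩ := mem_iUnion.1 hγ
        exact (q n).U_sub γ hn
      U_card := by
        have h := Cardinal.mk_iUnion_le_lift fun n => (q n).U
        rw [Cardinal.lift_id'.{0, u + 1}] at h
        refine h.trans ?_
        rw [Cardinal.mk_nat, Cardinal.lift_aleph0]
        refine (mul_le_mul' (Cardinal.aleph0_le_aleph 1) (ciSup_le' fun n => ?_)).trans
          (Cardinal.mul_eq_self (Cardinal.aleph0_le_aleph 1)).le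
        rw [Cardinal.lift_id'.{0, u + 1}]
        exact (q n).U_card
      β_le := fun γ _ => hβlim γ
      b_dom := by
        intro γ hγ
        obtain ⟨i, hi⟩ := mem_iUnion.1 hγ
        ext x
        refine (PFun.mem_dom _ x).trans ⟨?_, ?_⟩
        · rintro ⟨y, hy⟩
          rcases mem_bR.1 hy with ⟨n, h⟩ | ⟨hγ, h, -⟩
          · obtain ⟨hx, hl⟩ := (q n).mem_t_of_b h
            exact ⟨Or.inl (mem_iUnion.2 ⟨n, hx⟩), Order.lt_add_one_iff.2 (hl.trans (hβle γ n))⟩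
          · exact ⟨Or.inr h, Order.lt_add_one_iff.2 (by rw [htopl x h, hβact hγ])⟩
        · rintro ⟨hx | hx, hl⟩
          · rw [Order.lt_add_one_iff] at hl
            obtain ⟨j, hj⟩ := mem_iUnion.1 hx
            obtain ⟨k, hk⟩ := hreach (hlen j x hj) hl
            obtain ⟨y, hy⟩ := exists_b_of_le hq hi hj hk (max i (max j k)) (le_max_left _ _)
              ((le_max_left _ _).trans (le_max_right _ _))
              ((le_max_right _ _).trans (le_max_right _ _))
            exact ⟨y, mem_bR.2 (Or.inl ⟨_, hy⟩)⟩
          · rw [Order.lt_add_one_iff, htopl x hx] at hl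
            exact ⟨v γ x, mem_bR.2 (Or.inr ⟨hactive hl, hx, rfl⟩)⟩
      b_mem := by
        intro γ _ x y hy T hT
        rcases mem_bR.1 hy with ⟨n, h⟩ | ⟨hγ, h, rfl⟩
        · obtain ⟨m, hm⟩ := (mem_kR.1 hT).resolve_right fun h' =>
            hnottop ((q n).mem_t_of_b h).1 h'.1
          have h' := mem_b_of_le hq (le_max_left n m) h
          exact (q (max n m)).b_mem γ ((q _).mem_U_of_b h') x y h' T
            (mem_k_of_le hq (le_max_right n m) hm)
        · rcases mem_kR.1 hT with ⟨n, h'⟩ | ⟨-, rfl⟩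
          · exact absurd h (hnottop ((q n).mem_t_of_k h'))
          · exact ⟨hKv x (htopb x h) ⟨γ, hγ, rfl⟩, by
              rw [hvl γ x hγ (htopb x h), htopl x h]⟩
      b_mono := by
        intro γ _ x hx x' hx' hxx' y hy y' hy'
        have hnt : ∀ z : BinSeq.{u}, z.length < (⨆ n, (q n).β γ) → z ∉ top := fun z hz h =>
          ((htopl z h).symm.trans_lt hz).not_ge (hβlim γ)
        obtain ⟨n, h⟩ := (mem_bR.1 hy).resolve_right fun h => hnt x hx.2 h.2.1
        obtain ⟨m, h'⟩ := (mem_bR.1 hy').resolve_right fun h => hnt x' hx'.2 h.2.1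
        obtain ⟨k, hk⟩ := hβlt hx'.2
        exact b_le_b hq h h' hxx' hk
      δ_le := by
        intro γ _
        refine ciSup_le fun n => ?_
        by_cases hγ : γ ∈ (q n).U
        · exact ((q n).δ_le γ hγ).trans (hlt n).le
        · rw [(q n).δ_off γ hγ]; exact zero_le
      f_dom := by
        intro γ hγ
        ext ξ
        refine (PFun.mem_dom _ ξ).trans ⟨?_, ?_⟩
        · rintro ⟨η, hη⟩
          obtain ⟨n, hn⟩ := mem_fR.1 hη
          have hd := (PFun.mem_dom _ ξ).2 ⟨η, hn⟩
          rw [(q n).f_dom γ ((q n).mem_U_of_f hn)] at hd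
          exact lt_of_lt_of_le hd
            (le_ciSup (f := fun n => (q n).δ γ) Ordinal.bddAbove_of_small n)
        · intro hξ
          obtain ⟨n, hn⟩ := exists_lt_of_lt_ciSup (mem_Iio.1 hξ)
          have hγn : γ ∈ (q n).U := by
            by_contra h
            rw [(q n).δ_off γ h] at hn
            exact not_lt_zero hn
          have hd : ξ ∈ ((q n).f γ).Dom := by
            rw [(q n).f_dom γ hγn]; exact hn
          obtain ⟨η, hη⟩ := (PFun.mem_dom _ ξ).1 hd
          exact ⟨η, mem_fR.2 ⟨n, hη⟩⟩
      f_lt := by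
        intro γ _ ξ η hη
        obtain ⟨n, hn⟩ := mem_fR.1 hη
        exact (q n).f_lt γ ((q n).mem_U_of_f hn) ξ η hn
      conservative := by
        intro x hx V hV hfin ε hxε hε
        obtain ⟨n, hn⟩ : ∃ n, x ∈ (q n).t := by
          refine mem_iUnion.1 (hx.1.resolve_right fun h => ?_)
          exact hx.2.ne (htopl x h)
        rcases hε.lt_or_eq with hlt' | rfl
        · have hev : ∀ᶠ i in Filter.atTop, ∀ γ ∈ V, γ ∈ (q i).U ∧
              (ε ≤ (⨆ n, (q n).β γ) → ε ≤ (q i).β γ) := by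
            refine (Filter.eventually_all_finite hfin).2 fun γ hγ => ?_
            obtain ⟨i, hi⟩ := mem_iUnion.1 (hV hγ)
            obtain ⟨j, hj⟩ : ∃ j, ε ≤ (⨆ n, (q n).β γ) → ε ≤ (q j).β γ := by
              by_cases h : ε ≤ ⨆ n, (q n).β γ
              · obtain ⟨j, hj⟩ := hreach hlt' h
                exact ⟨j, fun _ => hj⟩
              · exact ⟨0, fun h' => absurd h' h⟩
            filter_upwards [Filter.eventually_ge_atTop i, Filter.eventually_ge_atTop j]
              with k hk hk'
            exact ⟨Stronger.U_sub (hq hk) hi, fun h => (hj h).trans (β_mono_all (hq hk') γ)⟩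
          obtain ⟨m, hm⟩ := exists_lt_α hlt'
          obtain ⟨N, hN, hmN, hnN⟩ := (hev.and ((Filter.eventually_ge_atTop m).and
            (Filter.eventually_ge_atTop n))).exists
          have hxN := t_subset (hq hnN) hn
          obtain ⟨x', hx', hxx', hc⟩ := (q N).exists_conserves hxN (fun γ hγ => (hN γ hγ).1) hfin
            hxε (hm.le.trans (hα.monotone hmN))
          refine ⟨x', ⟨Or.inl (mem_iUnion.2 ⟨N, hx'.1⟩), hx'.2⟩, hxx', fun γ₁ h₁ γ₂ h₂ => ?_⟩
          rw [or_iff_not_imp_left, not_or, not_lt, not_lt]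
          rintro ⟨hl₁, hl₂⟩
          have e : ∀ γ ∈ V, ε ≤ (⨆ n, (q n).β γ) → (q N).b γ x = ofRel (bR γ) x ∧
              (q N).b γ x' = ofRel (bR γ) x' ∧ x'.length ≤ (q N).β γ := fun γ hγ hl =>
            ⟨(hbsub γ N).eq_of_mem_dom ((q N).mem_dom_b (hN γ hγ).1 hxN
                (hxε.le.trans ((hN γ hγ).2 hl))),
              (hbsub γ N).eq_of_mem_dom ((q N).mem_dom_b (hN γ hγ).1 hx'.1
                (hx'.2.trans_le ((hN γ hγ).2 hl))), hx'.2.trans_le ((hN γ hγ).2 hl)⟩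
          obtain ⟨e₁, e₁', hr₁⟩ := e γ₁ h₁ hl₁
          obtain ⟨e₂, e₂', hr₂⟩ := e γ₂ h₂ hl₂
          rw [← e₁, ← e₁', ← e₂, ← e₂']
          exact hc γ₁ h₁ γ₂ h₂ hr₁ hr₂
        · -- at the last level only the active functions matter
          have hz : (∃ n, x ∈ (q n).t) ∧ (V ∩ {γ | Active q γ}).Finite ∧
              V ∩ {γ | Active q γ} ⊆ {γ | Active q γ} :=
            ⟨⟨n, hn⟩, hfin.subset inter_subset_left, inter_subset_right⟩
          have hw : W x (V ∩ {γ | Active q γ}) ∈ top :=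
            ⟨(x, _), ⟨mem_iUnion.2 ⟨n, hn⟩, hz.2⟩, rfl⟩
          refine ⟨W x (V ∩ {γ | Active q γ}), ⟨Or.inr hw, htopl _ hw⟩, hWx _ _ hz.1 hz.2,
            fun γ₁ h₁ γ₂ h₂ => ?_⟩
          rw [or_iff_not_imp_left, not_or, not_lt, not_lt]
          rintro ⟨hl₁, hl₂⟩ he
          have a₁ := hactive hl₁
          have a₂ := hactive hl₂
          have hA : Agree q γ₁ γ₂ x := by
            obtain ⟨i, y, hy⟩ := a₁.exists_b hq hα hn
            have hy₂ := hbsub γ₁ i x y hy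
            rw [he] at hy₂
            exact ⟨y, ⟨i, hy⟩, (mem_bR.1 hy₂).resolve_right fun h => hnottop hn h.2.1⟩
          have hv := hWv x _ hz.1 hz.2 γ₁ ⟨h₁, a₁⟩ γ₂ ⟨h₂, a₂⟩ hA
          have hs : ∀ γ, Active q γ → ofRel (bR γ) (W x (V ∩ {γ | Active q γ})) =
              Part.some (v γ (W x (V ∩ {γ | Active q γ}))) := fun γ hγ =>
            Part.eq_some_iff.2 (mem_bR.2 (Or.inr ⟨hγ, hw, rfl⟩))
          rw [hs γ₁ a₁, hs γ₂ a₂, hv]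
      b_off := by
        intro γ hγ
        refine eq_empty_of_forall_notMem fun x hx => hγ ?_
        obtain ⟨y, hy⟩ := (PFun.mem_dom _ x).1 hx
        rcases mem_bR.1 hy with ⟨n, h⟩ | ⟨h, -⟩
        · exact mem_iUnion.2 ⟨n, (q n).mem_U_of_b h⟩
        · exact mem_iUnion.2 (h.exists_mem_U hα)
      β_off := by
        intro γ hγ
        refine le_antisymm (ciSup_le fun n => ?_) zero_le
        rw [(q n).β_off γ fun h => hγ (mem_iUnion.2 ⟨n, h⟩)]
      f_off := by
        intro γ hγ
        refine eq_empty_of_forall_notMem fun ξ hξ => hγ ?_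
        obtain ⟨η, hη⟩ := (PFun.mem_dom _ ξ).1 hξ
        obtain ⟨n, h⟩ := mem_fR.1 hη
        exact mem_iUnion.2 ⟨n, (q n).mem_U_of_f h⟩
      δ_off := by
        intro γ hγ
        refine le_antisymm (ciSup_le fun n => ?_) zero_le
        rw [(q n).δ_off γ fun h => hγ (mem_iUnion.2 ⟨n, h⟩)] }
  refine ⟨r, fun n => ⟨(hlt n).le, hte n, fun x T h => mem_kR.2 (Or.inl ⟨n, h⟩),
    subset_iUnion (fun n => (q n).U) n, fun γ _ => hbsub γ n,
    fun γ _ ξ η h => mem_fR.2 ⟨n, h⟩, ?_, ?_⟩⟩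
  · refine (countable_iUnion fun m =>
      Stronger.β_countable (hq (le_max_left n m))).mono fun γ hγ => ?_
    obtain ⟨m, hm⟩ := hβlt hγ.2
    exact mem_iUnion.2 ⟨m, hγ.1, hm.trans_le (β_mono_all (hq (le_max_right n m)) γ)⟩
  · refine (countable_iUnion fun m =>
      Stronger.δ_countable (hq (le_max_left n m))).mono fun γ hγ => ?_
    obtain ⟨m, hm⟩ := exists_lt_of_lt_ciSup hγ.2
    refine mem_iUnion.2 ⟨m, hγ.1, hm.trans_le (δ_mono_all (hq (le_max_right n m)) γ)⟩

/-! ### The winning strategy -/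

/-- A move that adds a level to the tree, and after which `b γ` reaches at least the old last level,
or can never be extended again. -/
theorem exists_answer (p : Cond κ) (γ : Ordinal.{u}) :
    ∃ q ≤ p, p.α < q.α ∧ (γ ∈ p.U → p.α ≤ q.β γ ∨ ∀ r ≤ q, r.β γ ≤ q.β γ) := by
  by_cases hγ : γ ∈ p.U
  · obtain ⟨q, hqp, hα, h⟩ := p.exists_raise hγ
    refine ⟨q.addLevel, (addLevel_le q).trans hqp, hα ▸ lt_add_one q.α, fun _ => ?_⟩
    exact h.imp (fun h => h.ge) fun h r hr => h r (hr.trans (addLevel_le q))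
  · exact ⟨p.addLevel, addLevel_le p, lt_add_one p.α, fun h => absurd h hγ⟩

/-- An answer to `p` that takes care of `γ`. -/
noncomputable def reply (p : Cond κ) (γ : Ordinal.{u}) : Cond κ := (exists_answer p γ).choose

theorem reply_le (p : Cond κ) (γ : Ordinal.{u}) : p.reply γ ≤ p :=
  (exists_answer p γ).choose_spec.1

theorem α_lt_reply (p : Cond κ) (γ : Ordinal.{u}) : p.α < (p.reply γ).α :=
  (exists_answer p γ).choose_spec.2.1

theorem reply_β (p : Cond κ) {γ : Ordinal.{u}} (hγ : γ ∈ p.U) :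
    p.α ≤ (p.reply γ).β γ ∨ ∀ r ≤ p.reply γ, r.β γ ≤ (p.reply γ).β γ :=
  (exists_answer p γ).choose_spec.2.2 hγ

/-- The indices of the functions `b γ` of `p` whose domains are larger in `q`. -/
def enlarged (p q : Cond κ) : Set Ordinal.{u} := {γ ∈ p.U | p.β γ < q.β γ}

theorem exists_enumeration (C : Set Ordinal.{u}) :
    ∃ e : ℕ → Ordinal.{u}, C.Countable → C ⊆ range e := by
  by_cases hC : C.Countable
  · obtain ⟨e, he⟩ := countable_iff_exists_subset_range.1 hC
    exact ⟨e, fun _ => he⟩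
  · exact ⟨fun _ => 0, fun h => absurd h hC⟩

/-- A sequence that lists the elements of `C`, if `C` is countable. -/
noncomputable def enumeration (C : Set Ordinal.{u}) : ℕ → Ordinal.{u} :=
  (exists_enumeration C).choose

/-- The index that player II takes care of in her `n`-th move. If `n` codes `(i, j, c)`, it is the
`j`-th index whose function was enlarged between the moves `p i` and `p (i + 1)` of player I. -/
noncomputable def target (p : ℕ → Cond κ) (n : ℕ) : Ordinal.{u} :=
  enumeration (enlarged (p n.unpair.1.unpair.1) (p (n.unpair.1.unpair.1 + 1))) n.unpair.1.unpair.2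

/-- The strategy of player II: always make the tree higher, and take care of each index whose
function has been enlarged, infinitely often. The moves of player I that are still unknown are
replaced by his last move. -/
noncomputable def strategy (κ : Cardinal.{u}) : StrategyII (Cond κ) := fun n p =>
  (p (Fin.last n)).reply (target (fun m => p ⟨min m n, Nat.lt_succ_of_le (min_le_right m n)⟩) n)

theorem strategy_answer (p : ℕ → Cond κ) (n : ℕ) :
    (strategy κ).answer p n = (p n).reply (target (fun m => p (min m n)) n) := rfl

/-- Each enlarged index is taken care of infinitely often. -/
theorem exists_target_eq {p : ℕ → Cond κ} {i : ℕ} (hp : p (i + 1) ≤ p i) {γ : Ordinal.{u}}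
    (hγ : γ ∈ enlarged (p i) (p (i + 1))) (N : ℕ) :
    ∃ n ≥ N, target (fun m => p (min m n)) n = γ := by
  have hC : (enlarged (p i) (p (i + 1))).Countable := Stronger.β_countable hp
  obtain ⟨j, hj⟩ := (exists_enumeration (enlarged (p i) (p (i + 1)))).choose_spec hC hγ
  have hle : max N (i + 1) ≤ Nat.pair (Nat.pair i j) (max N (i + 1)) := Nat.right_le_pair _ _
  refine ⟨Nat.pair (Nat.pair i j) (max N (i + 1)), (le_max_left _ _).trans hle, ?_⟩
  have hi := (le_max_right N (i + 1)).trans hle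
  unfold target
  simp only [Nat.unpair_pair]
  rw [min_eq_left hi, min_eq_left ((Nat.le_succ i).trans hi)]
  exact hj

theorem strategy_isWinning : (strategy κ).IsWinning where
  legal p n _ := reply_le _ _
  lower_bound := by
    intro p hp
    have hle : ∀ n, (strategy κ).answer p n ≤ p n := fun n => reply_le _ _
    have hpa : Antitone p := antitone_nat_of_succ_le fun n => (hp n).trans (hle n)
    have hq : Antitone ((strategy κ).answer p) := antitone_nat_of_succ_le fun n =>
      (hle (n + 1)).trans (hp n)
    have hα : StrictMono fun n => ((strategy κ).answer p n).α := strictMono_nat_of_lt_succ fun n =>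
      (Stronger.α_le (hp n)).trans_lt (α_lt_reply _ _)
    obtain ⟨r, hr⟩ := exists_lower_bound hq hα (fun γ => by
      by_contra hcon
      push Not at hcon
      obtain ⟨hact, hne⟩ := hcon
      -- `γ` is the index of a function of player I that gets enlarged
      have hinc : ∀ n, ∃ m ≥ n, ((strategy κ).answer p n).β γ < ((strategy κ).answer p m).β γ := by
        intro n
        obtain ⟨m, hm, h⟩ := hne n
        exact ⟨m, hm, (β_mono_all (hq hm) γ).lt_of_ne' h⟩
      obtain ⟨m, -, hm⟩ := hinc 0
      have hγm : γ ∈ ((strategy κ).answer p m).U := by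
        by_contra h
        rw [((strategy κ).answer p m).β_off γ h] at hm
        exact not_lt_zero hm
      have hγp : ∀ i ≥ m + 1, γ ∈ (p i).U := fun i hi =>
        Stronger.U_sub ((hpa hi).trans (hp m)) hγm
      obtain ⟨i, hi, hlt⟩ : ∃ i ≥ m + 1, (p i).β γ < (p (i + 1)).β γ := by
        by_contra hcon
        push Not at hcon
        have hconst : ∀ i ≥ m + 1, (p i).β γ ≤ (p (m + 1)).β γ := by
          intro i hi
          induction i, hi using Nat.le_induction with
          | base => exact le_rfl
          | succ i hi ih => exact (hcon i hi).trans ih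
        obtain ⟨m', hm', h⟩ := hinc (m + 1)
        exact (((β_mono_all (hle (m + 1)) γ).trans_lt h).trans_le
          (β_mono_all (hp m') γ)).not_ge (hconst (m' + 1) (Nat.le_succ_of_le hm'))
      refine hact fun N => ?_
      obtain ⟨n, hn, ht⟩ := exists_target_eq (hpa (Nat.le_succ i)) ⟨hγp i hi, hlt⟩
        (max (N + 1) (m + 1))
      have hn₁ : N + 1 ≤ n := (le_max_left _ _).trans hn
      have hn₂ : m + 1 ≤ n := (le_max_right _ _).trans hn
      have hrep := (p n).reply_β (hγp n hn₂)
      have ha : (p n).reply γ = (strategy κ).answer p n := by rw [strategy_answer, ht]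
      rw [ha] at hrep
      rcases hrep with h | h
      · exact ⟨n, (Stronger.α_le ((hpa hn₁).trans (hp N))).trans h⟩
      · obtain ⟨k, hk, hlt⟩ := hinc n
        exact absurd (h _ (hq hk)) hlt.not_ge)
    exact ⟨r, fun n => ⟨(hr n).trans (hle n), hr n⟩⟩

end Cond

end KurepaForcing

theorem lemma12 (κ : Cardinal.{u}) (hκ : κ.IsInaccessible) :
    KurepaForcing.IsStrategicallyClosed (KurepaForcing.Cond κ) :=
  ⟨KurepaForcing.Cond.strategy κ, KurepaForcing.Cond.strategy_isWinning⟩
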